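/- Let $K$ be an integral domain of characteristic $0$ and let $q\in K$ be an invertible element which is a square in $K$ and such that $q+1$ is invertible in $K$. For $x,y$ in a ring put $V(x,y)=xyx+xy+yx+x+y+1$. For $m\ge 2$ let $\widehat{TL}_m(q)$ be the unital associative $K$-algebra generated by $g_{\sigma_1},\dots,g_{\sigma_{m-1}},g_{a_m}$ subject to the relations $g^2=(q-1)g+q$ for each generator $g$ and, if $m\ge 3$, the further relations - $g_{\sigma_i}g_{\sigma_j}=g_{\sigma_j}g_{\sigma_i}$ for $1\le i,j\le m-1$, $|i-j|\ge 2$, and $g_{\sigma_i}g_{a_m}=g_{a_m}g_{\sigma_i}$ for $2\le i\le m-2$; - $g_{\sigma_i}g_{\sigma_{i+1}}g_{\sigma_i}=g_{\sigma_{i+1}}g_{\sigma_i}g_{\sigma_{i+1}}$ for $1\le i\le m-2$, and $g_{\sigma_i}g_{a_m}g_{\sigma_i}=g_{a_m}g_{\sigma_i}g_{a_m}$ for $i\in\{1,m-1\}$; - $V(g_{\sigma_i},g_{\sigma_{i+1}})=0$ for $1\le i\le m-2$, and $V(g_{\sigma_1},g_{a_m})=V(g_{\sigma_{m-1}},g_{a_m})=0$.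 For $n\ge 2$ let $F_n:\widehat{TL}_n(q)\to\widehat{TL}_{n+1}(q)$ be the homomorphism of $K$-algebras that sends the generator $g_{\sigma_i}$ of $\widehat{TL}_n(q)$ to $g_{\sigma_i}$ for $1\le i\le n-1$ and the generator $g_{a_n}$ to $g_{\sigma_n}g_{a_{n+1}}g_{\sigma_n}^{-1}$. A Markov element of $\widehat{TL}_{n+1}(q)$ is an element of the form $A\,g_{\sigma_n}^{\varepsilon}B$ with $A,B\in F_n(\widehat{TL}_n(q))$ and $\varepsilon\in\{0,1\}$. A trace on $\widehat{TL}_{n+1}(q)$ is a $K$-linear map $\tau:\widehat{TL}_{n+1}(q)\to K$ with $\tau(xy)=\tau(yx)$ for all $x,y$. Theorem. Let $n\ge 2$. Any trace on $\widehat{TL}_{n+1}(q)$ is uniquely determined by its values on the Markov elements: if two traces on $\widehat{TL}_{n+1}(q)$ take the same value at every Markov element, then they are equal. -/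

import Mathlib

/-- The Temperley–Lieb element `V(x, y) = xyx + xy + yx + x + y + 1` of a ring. -/
def tlV {R : Type*} [Ring R] (x y : R) : R :=
  x * y * x + x * y + y * x + x + y + 1

/-- Names of the generators of the affine Temperley–Lieb algebra of rank `n`:
`σ₁, …, σₙ₋₁` and `aₙ`. For `n ≤ 1` there are none. -/
inductive AffGen (n : ℕ) : Type
  | sigma (i : ℕ) (h₁ : 1 ≤ i) (h₂ : i + 1 ≤ n) : AffGen n
  | a (h : 2 ≤ n) : AffGen n

/-- The defining relations of the affine Temperley–Lieb algebra of rank `n`, imposed on the free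
algebra on the generators. For `n = 2` only the two quadratic relations are present. -/
inductive AffRel (K : Type*) [CommRing K] (q : K) (n : ℕ) :
    FreeAlgebra K (AffGen n) → FreeAlgebra K (AffGen n) → Prop
  | comm_sigma (i j : ℕ) (hi₁ : 1 ≤ i) (hi₂ : i + 1 ≤ n) (hj₁ : 1 ≤ j) (hj₂ : j + 1 ≤ n)
      (hij : i + 2 ≤ j ∨ j + 2 ≤ i) :
      AffRel K q n
        (FreeAlgebra.ι K (.sigma i hi₁ hi₂) * FreeAlgebra.ι K (.sigma j hj₁ hj₂))
        (FreeAlgebra.ι K (.sigma j hj₁ hj₂) * FreeAlgebra.ι K (.sigma i hi₁ hi₂))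
  | comm_a (i : ℕ) (hi₁ : 2 ≤ i) (hi₂ : i + 2 ≤ n) :
      AffRel K q n
        (FreeAlgebra.ι K (.sigma i (by omega) (by omega)) * FreeAlgebra.ι K (.a (by omega)))
        (FreeAlgebra.ι K (.a (by omega)) * FreeAlgebra.ι K (.sigma i (by omega) (by omega)))
  | braid_sigma (i : ℕ) (hi₁ : 1 ≤ i) (hi₂ : i + 2 ≤ n) :
      AffRel K q n
        (FreeAlgebra.ι K (.sigma i (by omega) (by omega)) *
          FreeAlgebra.ι K (.sigma (i + 1) (by omega) (by omega)) *
          FreeAlgebra.ι K (.sigma i (by omega) (by omega)))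
        (FreeAlgebra.ι K (.sigma (i + 1) (by omega) (by omega)) *
          FreeAlgebra.ι K (.sigma i (by omega) (by omega)) *
          FreeAlgebra.ι K (.sigma (i + 1) (by omega) (by omega)))
  | braid_a (i : ℕ) (hn : 3 ≤ n) (hi : i = 1 ∨ i + 1 = n) :
      AffRel K q n
        (FreeAlgebra.ι K (.sigma i (by omega) (by omega)) * FreeAlgebra.ι K (.a (by omega)) *
          FreeAlgebra.ι K (.sigma i (by omega) (by omega)))
        (FreeAlgebra.ι K (.a (by omega)) * FreeAlgebra.ι K (.sigma i (by omega) (by omega)) *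
          FreeAlgebra.ι K (.a (by omega)))
  | quadratic (s : AffGen n) :
      AffRel K q n (FreeAlgebra.ι K s * FreeAlgebra.ι K s)
        ((q - 1) • FreeAlgebra.ι K s + algebraMap K _ q)
  | tl_sigma (i : ℕ) (hi₁ : 1 ≤ i) (hi₂ : i + 2 ≤ n) :
      AffRel K q n
        (tlV (FreeAlgebra.ι K (.sigma i (by omega) (by omega)))
          (FreeAlgebra.ι K (.sigma (i + 1) (by omega) (by omega)))) 0
  | tl_a (i : ℕ) (hn : 3 ≤ n) (hi : i = 1 ∨ i + 1 = n) :
      AffRel K q n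
        (tlV (FreeAlgebra.ι K (.sigma i (by omega) (by omega)))
          (FreeAlgebra.ι K (.a (by omega)))) 0

/-- The affine Temperley–Lieb algebra of rank `n` with parameter `q` over `K`: the unital
associative `K`-algebra presented by the generators `AffGen n` and the relations `AffRel K q n`.
It is `K` itself for `n = 1`. -/
abbrev AffineTL (K : Type*) [CommRing K] (q : K) (n : ℕ) : Type _ :=
  RingQuot (AffRel K q n)

namespace AffineTL

section
variable {K : Type*} [CommRing K]

/-- The generator of the affine Temperley–Lieb algebra with a given name. -/
def gen (q : K) {n : ℕ} (s : AffGen n) : AffineTL K q n :=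
  RingQuot.mkAlgHom K (AffRel K q n) (FreeAlgebra.ι K s)

/-- The generator `g_{σᵢ}`, for `1 ≤ i ≤ n - 1`. -/
def gSigma (q : K) {n : ℕ} (i : ℕ) (h₁ : 1 ≤ i) (h₂ : i + 1 ≤ n) : AffineTL K q n :=
  gen q (.sigma i h₁ h₂)

/-- The generator `g_{aₙ}`, for `n ≥ 2`. -/
def gA (q : K) {n : ℕ} (h : 2 ≤ n) : AffineTL K q n :=
  gen q (.a h)

theorem gen_mul_self (q : K) {n : ℕ} (s : AffGen n) :
    gen q s * gen q s = (q - 1) • gen q s + algebraMap K _ q := by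
  have h := RingQuot.mkAlgHom_rel K (AffRel.quadratic (q := q) s)
  simpa [gen] using h

theorem gSigma_comm (q : K) {n : ℕ} (i j : ℕ) (hi₁ : 1 ≤ i) (hi₂ : i + 1 ≤ n) (hj₁ : 1 ≤ j)
    (hj₂ : j + 1 ≤ n) (hij : i + 2 ≤ j ∨ j + 2 ≤ i) :
    gSigma q i hi₁ hi₂ * gSigma q j hj₁ hj₂ = gSigma q j hj₁ hj₂ * gSigma q i hi₁ hi₂ := by
  have h := RingQuot.mkAlgHom_rel K (AffRel.comm_sigma (q := q) i j hi₁ hi₂ hj₁ hj₂ hij)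
  simpa [gSigma, gen] using h

theorem gSigma_gA_comm (q : K) {n : ℕ} (i : ℕ) (hi₁ : 2 ≤ i) (hi₂ : i + 2 ≤ n) :
    gSigma q (n := n) i (by omega) (by omega) * gA q (by omega) =
      gA q (by omega) * gSigma q i (by omega) (by omega) := by
  have h := RingQuot.mkAlgHom_rel K (AffRel.comm_a (q := q) i hi₁ hi₂)
  simpa [gSigma, gA, gen] using h

theorem gSigma_braid (q : K) {n : ℕ} (i : ℕ) (hi₁ : 1 ≤ i) (hi₂ : i + 2 ≤ n) :
    gSigma q (n := n) i (by omega) (by omega) * gSigma q (i + 1) (by omega) (by omega) *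
        gSigma q i (by omega) (by omega) =
      gSigma q (i + 1) (by omega) (by omega) * gSigma q i (by omega) (by omega) *
        gSigma q (i + 1) (by omega) (by omega) := by
  have h := RingQuot.mkAlgHom_rel K (AffRel.braid_sigma (q := q) i hi₁ hi₂)
  simpa [gSigma, gA, gen] using h

theorem gSigma_gA_braid (q : K) {n : ℕ} (i : ℕ) (hn : 3 ≤ n) (hi : i = 1 ∨ i + 1 = n) :
    gSigma q (n := n) i (by omega) (by omega) * gA q (by omega) *
        gSigma q i (by omega) (by omega) =
      gA q (by omega) * gSigma q i (by omega) (by omega) * gA q (by omega) := by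
  have h := RingQuot.mkAlgHom_rel K (AffRel.braid_a (q := q) i hn hi)
  simpa [gSigma, gA, gen] using h

theorem map_tlV {R S : Type*} [Ring R] [Ring S] (f : R →+* S) (x y : R) :
    f (tlV x y) = tlV (f x) (f y) := by
  simp [tlV]

theorem tlV_gSigma (q : K) {n : ℕ} (i : ℕ) (hi₁ : 1 ≤ i) (hi₂ : i + 2 ≤ n) :
    tlV (gSigma q (n := n) i (by omega) (by omega)) (gSigma q (i + 1) (by omega) (by omega)) =
      0 := by
  have h := RingQuot.mkAlgHom_rel K (AffRel.tl_sigma (q := q) i hi₁ hi₂)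
  simpa [gSigma, gA, gen, tlV] using h

theorem tlV_gSigma_gA (q : K) {n : ℕ} (i : ℕ) (hn : 3 ≤ n) (hi : i = 1 ∨ i + 1 = n) :
    tlV (gSigma q (n := n) i (by omega) (by omega)) (gA q (by omega)) = 0 := by
  have h := RingQuot.mkAlgHom_rel K (AffRel.tl_a (q := q) i hn hi)
  simpa [gSigma, gA, gen, tlV] using h

/-- When `q` is invertible each generator `g` is a unit, with inverse `q⁻¹ (g - (q - 1))`. -/
def genUnit (q : Kˣ) {n : ℕ} (s : AffGen n) : (AffineTL K (q : K) n)ˣ where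
  val := gen (q : K) s
  inv := ((q⁻¹ : Kˣ) : K) • (gen (q : K) s - algebraMap K _ ((q : K) - 1))
  val_inv := by
    rw [mul_smul_comm, mul_sub, gen_mul_self, ← Algebra.commutes, ← Algebra.smul_def,
      add_sub_cancel_left, Algebra.algebraMap_eq_smul_one, smul_smul, Units.inv_mul, one_smul]
  inv_val := by
    rw [smul_mul_assoc, sub_mul, gen_mul_self, ← Algebra.smul_def,
      add_sub_cancel_left, Algebra.algebraMap_eq_smul_one, smul_smul, Units.inv_mul, one_smul]

/-- The generator `g_{σᵢ}` as a unit. -/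
def uSigma (q : Kˣ) {n : ℕ} (i : ℕ) (h₁ : 1 ≤ i) (h₂ : i + 1 ≤ n) : (AffineTL K (q : K) n)ˣ :=
  genUnit q (.sigma i h₁ h₂)

/-- The images of the generators under the tower morphism from rank `n` to rank `n + 1`:
`σᵢ ↦ g_{σᵢ}` for `1 ≤ i ≤ n - 1`, and `aₙ ↦ g_{σₙ} g_{aₙ₊₁} g_{σₙ}⁻¹`. -/
def towerGen (q : Kˣ) {n : ℕ} : AffGen n → AffineTL K (q : K) (n + 1)
  | .sigma i h₁ h₂ => gSigma (q : K) i h₁ (by omega)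
  | .a h => gSigma (q : K) n (by omega) le_rfl * gA (q : K) (n := n + 1) (by omega) *
      (((uSigma q n (by omega) le_rfl)⁻¹ : (AffineTL K (q : K) (n + 1))ˣ) :
        AffineTL K (q : K) (n + 1))

theorem val_uSigma (q : Kˣ) {n : ℕ} (i : ℕ) (h₁ : 1 ≤ i) (h₂ : i + 1 ≤ n) :
    ((uSigma q i h₁ h₂ : (AffineTL K (q : K) n)ˣ) : AffineTL K (q : K) n) =
      gSigma (q : K) i h₁ h₂ := rfl

theorem tlV_conj {R : Type*} [Ring R] (u : Rˣ) (x y : R) :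
    tlV ((u : R) * x * (u⁻¹ : Rˣ)) ((u : R) * y * (u⁻¹ : Rˣ)) = u * tlV x y * (u⁻¹ : Rˣ) := by
  simp [tlV, mul_add, add_mul, mul_assoc]

theorem conj_of_commute {R : Type*} [Ring R] (u : Rˣ) {x : R} (h : x * (u : R) = u * x) :
    (u : R) * x * (u⁻¹ : Rˣ) = x := by
  rw [← h, mul_assoc, Units.mul_inv, mul_one]

theorem conj_mul_conj {R : Type*} [Ring R] (u : Rˣ) (x y : R) :
    ((u : R) * x * (u⁻¹ : Rˣ)) * ((u : R) * y * (u⁻¹ : Rˣ)) = u * (x * y) * (u⁻¹ : Rˣ) := by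
  simp [mul_assoc]

theorem conj_braid {R : Type*} [Ring R] (u x : Rˣ) (h : (x : R) * u * x = u * x * u) :
    (x : R) = ((u * x : Rˣ) : R) * u * ((u * x)⁻¹ : Rˣ) := by
  rw [Units.eq_mul_inv_iff_mul_eq, Units.val_mul, ← mul_assoc, h]

theorem towerGen_a (q : Kˣ) {n : ℕ} (h : 2 ≤ n) :
    towerGen q (.a h) =
      ((uSigma q n (by omega) le_rfl : (AffineTL K (q : K) (n + 1))ˣ) :
          AffineTL K (q : K) (n + 1)) * gA (q : K) (by omega) *
        (((uSigma q n (by omega) le_rfl)⁻¹ : (AffineTL K (q : K) (n + 1))ˣ) :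
          AffineTL K (q : K) (n + 1)) := rfl

/-- For `i = 1` or `i = n - 1` the images of `σᵢ` and `aₙ` are simultaneously conjugate to
neighbouring generators of the algebra of rank `n + 1`. -/
theorem towerGen_conj (q : Kˣ) {n : ℕ} (i : ℕ) (hn : 3 ≤ n) (hi : i = 1 ∨ i + 1 = n) :
    ∃ (w : (AffineTL K (q : K) (n + 1))ˣ) (j : ℕ) (hj : j = 1 ∨ j + 1 = n + 1),
      towerGen q (n := n) (.sigma i (by omega) (by omega)) =
        w * gSigma (q : K) (n := n + 1) j (by omega) (by omega) * (w⁻¹ : (AffineTL K (q : K) (n + 1))ˣ) ∧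
      towerGen q (n := n) (.a (by omega)) =
        w * gA (q : K) (n := n + 1) (by omega) * (w⁻¹ : (AffineTL K (q : K) (n + 1))ˣ) := by
  rcases hi with rfl | hi
  · refine ⟨uSigma q n (by omega) le_rfl, 1, Or.inl rfl, ?_, rfl⟩
    refine (conj_of_commute _ ?_).symm
    exact gSigma_comm (q : K) 1 n _ _ _ _ (by omega)
  · refine ⟨uSigma q n (by omega) le_rfl * uSigma q i (by omega) (by omega), n, Or.inr rfl,
      ?_, ?_⟩
    · refine conj_braid (uSigma q n (by omega) le_rfl) (uSigma q i (by omega) (by omega)) ?_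
      subst hi
      exact gSigma_braid (q : K) i _ _
    · have h := conj_of_commute (uSigma q (n := n + 1) i (by omega) (by omega))
        (gSigma_gA_comm (q : K) (n := n + 1) i (by omega) (by omega)).symm
      rw [towerGen_a]
      conv_lhs => rw [← h]
      simp [mul_assoc]

/-- The images of the generators of rank `n` satisfy the defining relations of rank `n`. -/
theorem towerGen_rel (q : Kˣ) {n : ℕ} ⦃x y : FreeAlgebra K (AffGen n)⦄
    (h : AffRel K (q : K) n x y) :
    FreeAlgebra.lift K (towerGen q) x = FreeAlgebra.lift K (towerGen q) y := by
  cases h with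
  | comm_sigma i j hi₁ hi₂ hj₁ hj₂ hij =>
    simpa [towerGen] using gSigma_comm (q : K) i j _ _ _ _ hij
  | comm_a i hi₁ hi₂ =>
    simp only [map_mul, FreeAlgebra.lift_ι_apply]
    have hc := conj_of_commute (uSigma q (n := n + 1) n (by omega) le_rfl)
      (gSigma_comm (q : K) i n (by omega) (by omega) (by omega) le_rfl (by omega))
    have h₁ : towerGen q (n := n) (.sigma i (by omega) (by omega)) = _ := hc.symm
    rw [h₁, towerGen_a, conj_mul_conj, conj_mul_conj, gSigma_gA_comm (q : K) i hi₁ (by omega)]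
  | braid_sigma i hi₁ hi₂ =>
    simpa [towerGen] using gSigma_braid (q : K) (n := n + 1) i hi₁ (by omega)
  | braid_a i hn hi =>
    obtain ⟨w, j, hj, h₁, h₂⟩ := towerGen_conj q i hn hi
    simp only [map_mul, FreeAlgebra.lift_ι_apply]
    rw [h₁, h₂]
    simp only [conj_mul_conj]
    rw [gSigma_gA_braid (q : K) j (by omega) hj]
  | quadratic s =>
    simp only [map_mul, map_add, map_smul, FreeAlgebra.lift_ι_apply, AlgHom.commutes]
    cases s with
    | sigma i h₁ h₂ => exact gen_mul_self (q : K) _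
    | a h =>
      rw [towerGen_a, conj_mul_conj, gA, gen_mul_self, mul_add, add_mul, mul_smul_comm, smul_mul_assoc,
        ← Algebra.commutes (q : K) ((uSigma q n _ _ : (AffineTL K (q : K) (n + 1))ˣ) :
          AffineTL K (q : K) (n + 1)), mul_assoc (algebraMap K _ (q : K)), Units.mul_inv, mul_one]
  | tl_sigma i hi₁ hi₂ =>
    simpa [towerGen, tlV] using tlV_gSigma (q : K) (n := n + 1) i hi₁ (by omega)
  | tl_a i hn hi =>
    obtain ⟨w, j, hj, h₁, h₂⟩ := towerGen_conj q i hn hi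
    have := map_tlV (FreeAlgebra.lift K (towerGen q (n := n))).toRingHom
      (FreeAlgebra.ι K (.sigma i (by omega) (by omega))) (FreeAlgebra.ι K (.a (by omega)))
    simp only [AlgHom.toRingHom_eq_coe, RingHom.coe_coe, FreeAlgebra.lift_ι_apply] at this
    rw [this, h₁, h₂, tlV_conj, tlV_gSigma_gA (q : K) j (by omega) hj]
    simp

/-- The tower morphism `Fₙ` from the affine Temperley–Lieb algebra of rank `n` to that of rank
`n + 1`: `t_{σᵢ} ↦ g_{σᵢ}` for `1 ≤ i ≤ n - 1` and `t_{aₙ} ↦ g_{σₙ} g_{aₙ₊₁} g_{σₙ}⁻¹`. -/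
def F (q : Kˣ) (n : ℕ) : AffineTL K (q : K) n →ₐ[K] AffineTL K (q : K) (n + 1) :=
  RingQuot.liftAlgHom K ⟨FreeAlgebra.lift K (towerGen q), towerGen_rel q⟩

theorem F_gen (q : Kˣ) (n : ℕ) (s : AffGen n) : F q n (gen (q : K) s) = towerGen q s := by
  simp [F, gen]

/-- Markov elements of the affine Temperley–Lieb algebra of rank `n + 1`: the elements
`A g_{σₙ}^ε B` with `A`, `B` in the image of `Fₙ` and `ε ∈ {0, 1}`. -/
def IsMarkov (q : Kˣ) {n : ℕ} (hn : 2 ≤ n) (x : AffineTL K (q : K) (n + 1)) : Prop :=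
  ∃ A ∈ (F q n).range, ∃ B ∈ (F q n).range, ∃ ε : ℕ, (ε = 0 ∨ ε = 1) ∧
    x = A * gSigma (q : K) n (by omega) le_rfl ^ ε * B

end

end AffineTL

/-- A trace on a `K`-algebra: a `K`-linear form `τ` with `τ (x y) = τ (y x)`. -/
def IsTraceForm {K R : Type*} [CommRing K] [Ring R] [Algebra K R] (τ : R →ₗ[K] K) : Prop :=
  ∀ x y : R, τ (x * y) = τ (y * x)

/-! Put `e_i = g_{σ_i} + 1` and `e_0 = g_{a_{n+1}} + 1`. Along a cycle of `n + 1` nodes these are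
scaled idempotents with `e_i e_j e_i = q e_i` for neighbours, and non-neighbours commute. Let `b =
e_n`, `a = e_0`, let `U` be the algebra generated by `e_1, …, e_{n-1}`, and let `S` be the image of
the tower morphism. Then `S` contains `U` and `c = F(g_{a_n} + 1) = b + a - b a - q⁻¹ a b`. The
difference of the two traces vanishes on `S` and on `b S`; it has to vanish on all words. The
induction is on the number of letters `a`, `b`, and since scalars never matter it is run on
submodules.

Both `b U b` and `a U a` are shorter, so only alternating words matter (`pow_le_alternating`). One
of odd length begins and ends with the same letter, hence shortens after a rotation (`null_odd`).

For even length, `b U a` lies in `U b a U + U b d a U` with `d = e_{n-1} ⋯ e_1`. Up to shorter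
words, a factor `b d a` followed by one in `U b a U` becomes another factor in `U b a U`, so
cyclicity leaves only pure powers of the two kinds (`null_sorted`). In a power of `b a U`, every `b
a` but the first can be replaced by `c`: the error `a b` creates a factor `a U a`. As `b a = b (1 -
q⁻¹ c)`, the power lies in `b S` up to shorter words (`baU_pow_le`). Powers of `b d a` rotate to
powers of `d a b`, and the mirror argument applies (`Uab_pow_le`). -/

/-! ### Alternating words in an idempotent semiring -/

section CyclicReduction

/-- Products of submodules, taken in an abstract idempotent semiring: `U` plays the rôle of the
finite Temperley–Lieb algebra, `b` and `a` those of the lines spanned by the two remaining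
generators, `E` is the span of the words with at most one letter in `{a, b}`, and `S` and `C` are
the image of the tower morphism and the line spanned by its additional generator. -/
structure AlternatingData {A : Type*} [IdemSemiring A] (U a b d E S C : A) : Prop where
  one_le : 1 ≤ U
  U_mul_le : U * U ≤ U
  hE : E = U + U * b * U + U * a * U
  -- `d` stands for the line of the descending product of all generators of `U`, the only
  -- obstruction to clearing `U` from between `b` and `a`.
  d_le : d ≤ U
  bUb : b * U * b ≤ E
  aUa : a * U * a ≤ E
  bUa : b * U * a ≤ U * (b * a) * U + U * (b * d * a) * U
  bdaU : b * d * a * U ≤ b * d * a + U * (b * a) * U + E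
  aba : a * b * a ≤ a
  U_le_S : U ≤ S
  C_le_S : C ≤ S
  S_mul_le : S * S ≤ S
  C_le : C ≤ E * E
  -- One relation, `c = b + a - b a - q⁻¹ a b`, solved for each of three terms.
  a_le : a ≤ C + b + b * a + a * b
  ba_le : b * a ≤ C + a * b + E
  ab_le : a * b ≤ C + b * a + E
  ba_le_bS : b * a ≤ b * S
  ab_le_Sb : a * b ≤ S * b

/-- A property of elements of an idempotent semiring that behaves like being annihilated by a
trace. -/
structure IsTraceNull {A : Type*} [IdemSemiring A] (Z : A → Prop) : Prop where
  mono : ∀ {x y}, x ≤ y → Z y → Z x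
  add : ∀ {x y}, Z x → Z y → Z (x + y)
  comm : ∀ {x y}, Z (x * y) → Z (y * x)

namespace AlternatingData

variable {A : Type*} [IdemSemiring A] {U a b d E S C : A}

theorem U_mul_U (h : AlternatingData U a b d E S C) : U * U = U :=
  le_antisymm h.U_mul_le (le_mul_of_one_le_left' h.one_le)

theorem U_le_E (h : AlternatingData U a b d E S C) : U ≤ E := by
  rw [h.hE, add_assoc]; exact le_self_add

theorem UbU_le_E (h : AlternatingData U a b d E S C) : U * b * U ≤ E := by
  rw [h.hE]; exact le_self_add.trans' le_add_self

theorem UaU_le_E (h : AlternatingData U a b d E S C) : U * a * U ≤ E := by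
  rw [h.hE]; exact le_add_self

theorem one_le_E (h : AlternatingData U a b d E S C) : 1 ≤ E := h.one_le.trans h.U_le_E

theorem b_le_E (h : AlternatingData U a b d E S C) : b ≤ E :=
  ((le_mul_of_one_le_left' h.one_le).trans (le_mul_of_one_le_right' h.one_le)).trans h.UbU_le_E

theorem a_le_E (h : AlternatingData U a b d E S C) : a ≤ E :=
  ((le_mul_of_one_le_left' h.one_le).trans (le_mul_of_one_le_right' h.one_le)).trans h.UaU_le_E

theorem U_mul_E (h : AlternatingData U a b d E S C) : U * E = E := by
  simp only [h.hE, mul_add, ← mul_assoc, h.U_mul_U]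

theorem E_mul_U (h : AlternatingData U a b d E S C) : E * U = E := by
  simp only [h.hE, add_mul, mul_assoc, h.U_mul_U]

theorem pow_le_pow (h : AlternatingData U a b d E S C) {i j : ℕ} (hij : i ≤ j) : E ^ i ≤ E ^ j :=
  pow_le_pow_right' h.one_le_E hij

theorem UbUa_le (h : AlternatingData U a b d E S C) : U * b * U * a ≤ E ^ 2 := by
  rw [pow_two]; exact mul_le_mul' h.UbU_le_E h.a_le_E

theorem UaUb_le (h : AlternatingData U a b d E S C) : U * a * U * b ≤ E ^ 2 := by
  rw [pow_two]; exact mul_le_mul' h.UaU_le_E h.b_le_E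

theorem UbUa_pow_le (h : AlternatingData U a b d E S C) (k : ℕ) :
    (U * b * U * a) ^ k ≤ E ^ (2 * k) := by
  rw [pow_mul]; exact pow_le_pow_left' h.UbUa_le k

theorem UaUb_pow_le (h : AlternatingData U a b d E S C) (k : ℕ) :
    (U * a * U * b) ^ k ≤ E ^ (2 * k) := by
  rw [pow_mul]; exact pow_le_pow_left' h.UaUb_le k

theorem pow_mul_U (h : AlternatingData U a b d E S C) (p : ℕ) : E ^ (p + 1) * U = E ^ (p + 1) := by
  rw [pow_succ, mul_assoc, h.E_mul_U]

/-- Up to shorter words, words in `a` and `b` with coefficients in `U` are alternating. -/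
theorem pow_le_alternating (h : AlternatingData U a b d E S C) (k : ℕ) :
    E ^ (2 * k + 1) ≤ E ^ (2 * k) * U + (U * b * U * a) ^ k * U * b * U
        + (U * a * U * b) ^ k * U * a * U ∧
    E ^ (2 * k + 2) ≤ E ^ (2 * k + 1) + (U * b * U * a) ^ (k + 1) * U
        + (U * a * U * b) ^ (k + 1) * U := by
  -- A further factor `E` either continues the alternation or brings two equal letters together,
  -- which shortens. This half is isolated because the induction for odd exponents passes through
  -- it.
  have step : ∀ k, E ^ (2 * k + 1) ≤ E ^ (2 * k) * U + (U * b * U * a) ^ k * U * b * U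
        + (U * a * U * b) ^ k * U * a * U →
      E ^ (2 * k + 2) ≤ E ^ (2 * k + 1) + (U * b * U * a) ^ (k + 1) * U
        + (U * a * U * b) ^ (k + 1) * U := by
    intro k hk
    set x := (U * b * U * a) ^ k with hx
    set y := (U * a * U * b) ^ k with hy
    have hx' : x ≤ E ^ (2 * k) := h.UbUa_pow_le k
    have hy' : y ≤ E ^ (2 * k) := h.UaUb_pow_le k
    have e1 : (x * U * b * U + y * U * a * U) * E =
        (x * U * b * U + y * U * a * U) + x * U * (b * U * b) * U + y * U * (a * U * a) * U
        + (x * (U * b * U * a) * U + y * (U * a * U * b) * U) := by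
      rw [h.hE]
      simp only [mul_add, add_mul, mul_assoc]
      simp only [← mul_assoc U U, h.U_mul_U]
      abel
    have hz : (x * U * b * U + y * U * a * U) + x * U * (b * U * b) * U
        + y * U * (a * U * a) * U ≤ E ^ (2 * k + 1) := by
      refine add_le (add_le (add_le ?_ ?_) ?_) ?_
      · calc x * U * b * U = x * (U * b * U) := by simp only [mul_assoc]
          _ ≤ _ := by grw [hx', h.UbU_le_E, pow_succ]
      · calc y * U * a * U = y * (U * a * U) := by simp only [mul_assoc]
          _ ≤ _ := by grw [hy', h.UaU_le_E, pow_succ]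
      · calc x * U * (b * U * b) * U ≤ x * (U * E * U) := by
              grw [h.bUb]
              simp only [mul_assoc, le_refl]
          _ ≤ _ := by rw [h.U_mul_E, h.E_mul_U]; grw [hx', pow_succ]
      · calc y * U * (a * U * a) * U ≤ y * (U * E * U) := by
              grw [h.aUa]
              simp only [mul_assoc, le_refl]
          _ ≤ _ := by rw [h.U_mul_E, h.E_mul_U]; grw [hy', pow_succ]
    calc E ^ (2 * k + 2) = E ^ (2 * k + 1) * E := pow_succ _ _
      _ ≤ (E ^ (2 * k) * U + x * U * b * U + y * U * a * U) * E := by grw [hk]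
      _ = E ^ (2 * k) * (U * E) + (x * U * b * U + y * U * a * U) * E := by
        simp only [add_mul, mul_assoc, add_assoc]
      _ = E ^ (2 * k + 1) + (x * U * b * U + y * U * a * U) * E := by
        rw [h.U_mul_E, ← pow_succ]
      _ ≤ _ := by
        rw [e1, pow_succ (U * b * U * a), pow_succ (U * a * U * b), ← hx, ← hy]
        grw [hz]
        simp only [← add_assoc, add_idem, le_refl]
  suffices key : E ^ (2 * k + 1) ≤ E ^ (2 * k) * U + (U * b * U * a) ^ k * U * b * U
        + (U * a * U * b) ^ k * U * a * U from ⟨key, step k key⟩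
  induction k with
  | zero => simpa using h.hE.le
  | succ k ih =>
    have ih' := step k ih
    set x := (U * b * U * a) ^ (k + 1) with hx
    set y := (U * a * U * b) ^ (k + 1) with hy
    have hx' : x ≤ E ^ (2 * k + 2) := h.UbUa_pow_le (k + 1)
    have hy' : y ≤ E ^ (2 * k + 2) := h.UaUb_pow_le (k + 1)
    -- `x` ends in `a`, so a further `a` produces `a U a`, which counts as one letter.
    have hxa : x * U * a * U ≤ E ^ (2 * k + 2) := by
      calc x * U * a * U = (U * b * U * a) ^ k * (U * b * U) * ((a * U * a) * U) := by
            rw [hx, pow_succ]; simp only [mul_assoc]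
        _ ≤ E ^ (2 * k) * E * (E * U) := by grw [h.aUa, h.UbUa_pow_le, h.UbU_le_E]
        _ = _ := by rw [h.E_mul_U, ← pow_succ, ← pow_succ]
    have hyb : y * U * b * U ≤ E ^ (2 * k + 2) := by
      calc y * U * b * U = (U * a * U * b) ^ k * (U * a * U) * ((b * U * b) * U) := by
            rw [hy, pow_succ]; simp only [mul_assoc]
        _ ≤ E ^ (2 * k) * E * (E * U) := by grw [h.bUb, h.UaUb_pow_le, h.UaU_le_E]
        _ = _ := by rw [h.E_mul_U, ← pow_succ, ← pow_succ]
    have e1 : (x * U + y * U) * E =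
        (x * U + y * U) + (x * U * a * U + y * U * b * U) + (x * U * b * U + y * U * a * U) := by
      rw [h.hE]
      simp only [mul_add, add_mul, mul_assoc]
      simp only [← mul_assoc U U, h.U_mul_U]
      abel
    have hz : (x * U + y * U) + (x * U * a * U + y * U * b * U) ≤ E ^ (2 * k + 2) := by
      refine add_le (add_le ?_ ?_) (add_le hxa hyb)
      · grw [hx', h.pow_mul_U]
      · grw [hy', h.pow_mul_U]
    calc E ^ (2 * (k + 1) + 1) = E ^ (2 * k + 2) * E := pow_succ _ _
      _ ≤ (E ^ (2 * k + 1) + x * U + y * U) * E := by grw [ih']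
      _ = E ^ (2 * k + 2) + (x * U + y * U) * E := by
        rw [add_assoc, add_mul, ← pow_succ]
      _ ≤ _ := by
        rw [e1, show 2 * (k + 1) = 2 * k + 1 + 1 by ring, h.pow_mul_U]
        grw [hz]
        simp only [← add_assoc, add_idem, le_refl]

/-- Powers of `b a U` lie in `b S` up to shorter words. -/
theorem baU_pow_le (h : AlternatingData U a b d E S C) (k : ℕ) :
    (b * a * U) ^ (k + 1) ≤ b * S + E ^ (2 * k + 1) := by
  induction k with
  | zero =>
    rw [zero_add, pow_one]
    calc b * a * U ≤ b * (S * S) := by grw [h.ba_le_bS, h.U_le_S, mul_assoc]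
      _ ≤ _ := by grw [h.S_mul_le]; exact le_self_add
  | succ k ih =>
    have hba : (b * a * U) ≤ E ^ 2 := by
      rw [mul_assoc, pow_two]
      calc b * (a * U) ≤ E * (E * U) := by grw [h.b_le_E, h.a_le_E]
        _ = _ := by rw [h.E_mul_U]
    have hpow (j : ℕ) : (b * a * U) ^ j ≤ E ^ (2 * j) := by
      rw [pow_mul]; exact pow_le_pow_left' hba j
    -- The last `b a` is replaced by `C + a b + E`. The part in `C` stays in `b S`, and on the error
    -- term `C` counts as two letters.
    have h1 : (b * a * U) ^ (k + 1) * C ≤ b * S + E ^ (2 * k + 3) := by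
      calc (b * a * U) ^ (k + 1) * C ≤ (b * S + E ^ (2 * k + 1)) * C := by grw [ih]
        _ ≤ b * (S * S) + E ^ (2 * k + 1) * (E * E) := by
          rw [add_mul, mul_assoc]; nth_grw 1 [h.C_le_S]; grw [h.C_le]
        _ ≤ _ := by grw [h.S_mul_le, ← mul_assoc, ← pow_succ, ← pow_succ]
    -- The swapped pair puts `a` next to the preceding `a U`.
    have h2 : (b * a * U) ^ (k + 1) * (a * b) ≤ E ^ (2 * k + 3) := by
      calc (b * a * U) ^ (k + 1) * (a * b) = (b * a * U) ^ k * (b * (a * U * a) * b) := by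
            rw [pow_succ]; simp only [mul_assoc]
        _ ≤ E ^ (2 * k) * (E * E * E) := by grw [hpow, h.aUa, h.b_le_E]
        _ = _ := by rw [← pow_three', ← pow_add]
    have h3 : (b * a * U) ^ (k + 1) * E ≤ E ^ (2 * k + 3) := by
      grw [hpow, ← pow_succ]; exact (h.pow_le_pow (by omega))
    calc (b * a * U) ^ (k + 1 + 1) = (b * a * U) ^ (k + 1) * (b * a) * U := by
          rw [pow_succ]; simp only [mul_assoc]
      _ ≤ (b * a * U) ^ (k + 1) * (C + a * b + E) * U :=
        mul_le_mul_left (mul_le_mul_right h.ba_le _) _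
      _ ≤ (b * S + E ^ (2 * k + 3) + E ^ (2 * k + 3) + E ^ (2 * k + 3)) * U := by
        rw [mul_add, mul_add]; grw [h1, h2, h3]
      _ = b * (S * U) + E ^ (2 * k + 3) := by
        rw [add_assoc, add_assoc, add_idem, add_idem, add_mul, h.pow_mul_U, mul_assoc]
      _ ≤ _ := by grw [h.U_le_S, h.S_mul_le]; rfl

/-- Powers of `U a b` lie in `S b` up to shorter words. -/
theorem Uab_pow_le (h : AlternatingData U a b d E S C) (k : ℕ) :
    (U * a * b) ^ (k + 1) ≤ S * b + E ^ (2 * k + 1) := by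
  have hUE (p : ℕ) : U * E ^ (p + 1) = E ^ (p + 1) := by rw [pow_succ', ← mul_assoc, h.U_mul_E]
  induction k with
  | zero =>
    rw [zero_add, pow_one]
    calc U * a * b ≤ S * S * b := by
          rw [mul_assoc, mul_assoc]; grw [h.ab_le_Sb, h.U_le_S]
      _ ≤ _ := by grw [h.S_mul_le]; exact le_self_add
  | succ k ih =>
    have hba : (U * a * b) ≤ E ^ 2 := by
      rw [pow_two]
      calc U * a * b ≤ U * E * E := by grw [h.b_le_E, h.a_le_E]
        _ = _ := by rw [h.U_mul_E]
    have hpow (j : ℕ) : (U * a * b) ^ j ≤ E ^ (2 * j) := by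
      rw [pow_mul]; exact pow_le_pow_left' hba j
    have h1 : C * (U * a * b) ^ (k + 1) ≤ S * b + E ^ (2 * k + 3) := by
      calc C * (U * a * b) ^ (k + 1) ≤ C * (S * b + E ^ (2 * k + 1)) := by grw [ih]
        _ ≤ S * S * b + E * E * E ^ (2 * k + 1) := by
          rw [mul_add, ← mul_assoc]; nth_grw 1 [h.C_le_S]; grw [h.C_le]
        _ ≤ _ := by grw [h.S_mul_le, mul_assoc, ← pow_succ', ← pow_succ']
    have h2 : (b * a) * (U * a * b) ^ (k + 1) ≤ E ^ (2 * k + 3) := by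
      calc (b * a) * (U * a * b) ^ (k + 1) = (b * (a * U * a) * b) * (U * a * b) ^ k := by
            rw [pow_succ']; simp only [mul_assoc]
        _ ≤ (E * E * E) * E ^ (2 * k) := by grw [hpow, h.aUa, h.b_le_E]
        _ = _ := by rw [← pow_three', ← pow_add, add_comm]
    have h3 : E * (U * a * b) ^ (k + 1) ≤ E ^ (2 * k + 3) := by
      grw [hpow, ← pow_succ']; exact (h.pow_le_pow (by omega))
    calc (U * a * b) ^ (k + 1 + 1) = U * ((a * b) * (U * a * b) ^ (k + 1)) := by
          rw [pow_succ']; simp only [mul_assoc]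
      _ ≤ U * ((C + b * a + E) * (U * a * b) ^ (k + 1)) := by grw [h.ab_le]
      _ ≤ U * (S * b + E ^ (2 * k + 3) + E ^ (2 * k + 3) + E ^ (2 * k + 3)) := by
        rw [add_mul, add_mul]; grw [h1, h2, h3]
      _ = U * S * b + E ^ (2 * k + 3) := by
        rw [add_assoc, add_assoc, add_idem, add_idem, mul_add, hUE, mul_assoc]
      _ ≤ _ := by grw [h.U_le_S, h.S_mul_le]; rfl

/-! ### Sorting the factors of even words -/

theorem UbaU_le (h : AlternatingData U a b d E S C) : U * (b * a) * U ≤ E ^ 2 := by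
  calc U * (b * a) * U = U * b * (a * U) := by simp only [mul_assoc]
    _ ≤ U * E * (E * U) := by grw [h.b_le_E, h.a_le_E]
    _ = _ := by rw [h.U_mul_E, h.E_mul_U, pow_two]

theorem bda_le (h : AlternatingData U a b d E S C) : b * d * a ≤ E ^ 2 := by
  calc b * d * a ≤ E * U * E := by grw [h.b_le_E, h.a_le_E, h.d_le]
    _ = _ := by rw [h.E_mul_U, pow_two]

theorem UbaU_pow_le (h : AlternatingData U a b d E S C) (k : ℕ) :
    (U * (b * a) * U) ^ k ≤ E ^ (2 * k) := by
  rw [pow_mul]; exact pow_le_pow_left' h.UbaU_le k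

theorem bda_pow_le (h : AlternatingData U a b d E S C) (k : ℕ) : (b * d * a) ^ k ≤ E ^ (2 * k) := by
  rw [pow_mul]; exact pow_le_pow_left' h.bda_le k

/-- A factor `b d a` is absorbed by a following factor in `U b a U`, up to shorter words. -/
theorem bda_mul_UbaU_le (h : AlternatingData U a b d E S C) :
    b * d * a * (U * (b * a) * U) ≤ (U * (b * a) * U) ^ 2 + E ^ 3 := by
  -- `a b a` collapses: four letters become two.
  have h1 : b * d * a * (b * a * U) ≤ E ^ 3 := by
    calc b * d * a * (b * a * U) = b * d * (a * b * a) * U := by simp only [mul_assoc]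
      _ ≤ b * d * a * U := by grw [h.aba]
      _ ≤ E ^ 2 * U := by grw [h.bda_le]
      _ = E ^ 2 := h.pow_mul_U 1
      _ ≤ _ := h.pow_le_pow (by omega)
  have h2 : U * (b * a) * U * (b * a * U) ≤ (U * (b * a) * U) ^ 2 := by
    calc U * (b * a) * U * (b * a * U) = U * (b * a) * U * (1 * (b * a) * U) := by
          rw [one_mul]
      _ ≤ _ := by grw [h.one_le, pow_two]
  have h3 : E * (b * a * U) ≤ E ^ 3 := by
    calc E * (b * a * U) = E * (b * (a * U)) := by simp only [mul_assoc]
      _ ≤ E * (E * (E * U)) := by grw [h.b_le_E, h.a_le_E]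
      _ = _ := by rw [h.E_mul_U, pow_three]
  -- The left `U` of the second factor is handed to `b d a`, so that `bdaU` applies.
  calc b * d * a * (U * (b * a) * U) = b * d * a * U * (b * a * U) := by simp only [mul_assoc]
    _ ≤ (b * d * a + U * (b * a) * U + E) * (b * a * U) := by grw [h.bdaU]
    _ ≤ E ^ 3 + (U * (b * a) * U) ^ 2 + E ^ 3 := by rw [add_mul, add_mul]; grw [h1, h2, h3]
    _ = _ := by rw [add_comm (E ^ 3), add_assoc, add_idem]

/-- The factors `b d a` are converted one at a time, starting with the rightmost. At least one
factor in `U b a U` is needed to start, hence the exponent `i + 1`. -/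
theorem bda_pow_mul_UbaU_pow_le (h : AlternatingData U a b d E S C) (j i : ℕ) :
    (b * d * a) ^ j * (U * (b * a) * U) ^ (i + 1) ≤
      (U * (b * a) * U) ^ (i + 1 + j) + E ^ (2 * (i + j) + 1) := by
  induction j generalizing i with
  | zero => simp
  | succ j ih =>
    have hi := h.UbaU_pow_le i
    have ih' := ih (i + 1)
    have hm := h.bda_mul_UbaU_le
    set G := U * (b * a) * U
    calc (b * d * a) ^ (j + 1) * G ^ (i + 1)
        = (b * d * a) ^ j * (b * d * a * G) * G ^ i := by
          rw [pow_succ, pow_succ' _ i]; simp only [mul_assoc]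
      _ ≤ (b * d * a) ^ j * (G ^ 2 + E ^ 3) * G ^ i := by grw [hm]
      _ = (b * d * a) ^ j * G ^ (i + 1 + 1) + (b * d * a) ^ j * E ^ 3 * G ^ i := by
          rw [mul_add, add_mul, mul_assoc, ← pow_add, show 2 + i = i + 1 + 1 by ring]
      _ ≤ G ^ (i + 1 + 1 + j) + E ^ (2 * (i + 1 + j) + 1) +
          E ^ (2 * j) * E ^ 3 * E ^ (2 * i) := by
          grw [ih', h.bda_pow_le, hi]
      _ = _ := by
          rw [← pow_add, ← pow_add, show 2 * j + 3 + 2 * i = 2 * (i + 1 + j) + 1 by ring,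
            add_assoc, add_idem]
          ring_nf

/-- The span of the products of `k` factors from `U b a U` and `b d a` in which no factor from
`U b a U` follows a factor `b d a`. -/
def sorted (U a b d : A) : ℕ → A
  | 0 => 1
  | k + 1 => (U * (b * a) * U) ^ (k + 1) + sorted U a b d k * (b * d * a)

theorem sorted_le (h : AlternatingData U a b d E S C) (k : ℕ) : sorted U a b d k ≤ E ^ (2 * k) := by
  induction k with
  | zero => simp [sorted]
  | succ k ih =>
    rw [sorted]
    refine add_le (h.UbaU_pow_le _) ?_
    grw [ih, h.bda_le, ← pow_add]; rfl

/-- A factor in `U b a U` on the right converts every `b d a` to its left in turn, leaving a pure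
power. -/
theorem sorted_mul_UbaU_le (h : AlternatingData U a b d E S C) (k : ℕ) :
    sorted U a b d k * (U * (b * a) * U) ≤ (U * (b * a) * U) ^ (k + 1) + E ^ (2 * k + 1) := by
  induction k with
  | zero => simp [sorted]
  | succ k ih =>
    have hs := h.sorted_le k
    have hm := h.bda_mul_UbaU_le
    have hG := h.UbaU_le
    rw [sorted]
    set G := U * (b * a) * U
    set s := sorted U a b d k
    have h1 : E ^ (2 * k + 1) * G ≤ E ^ (2 * k + 3) := by grw [hG, ← pow_add]
    calc (G ^ (k + 1) + s * (b * d * a)) * G = G ^ (k + 2) + s * (b * d * a * G) := by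
          rw [add_mul, ← pow_succ, mul_assoc s]
      _ ≤ G ^ (k + 2) + s * (G ^ 2 + E ^ 3) := by grw [hm]
      _ = G ^ (k + 2) + (s * G * G + s * E ^ 3) := by rw [mul_add, pow_two, mul_assoc s]
      _ ≤ G ^ (k + 2) + ((G ^ (k + 1) + E ^ (2 * k + 1)) * G + E ^ (2 * k) * E ^ 3) := by
          grw [ih, hs]
      _ ≤ G ^ (k + 2) + (G ^ (k + 2) + E ^ (2 * k + 3) + E ^ (2 * k) * E ^ 3) := by
          rw [add_mul, ← pow_succ]; grw [h1]
      _ = _ := by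
          rw [← pow_add, add_assoc, add_idem, ← add_assoc, add_idem]
          rfl

/-- Of the three kinds of factor appended on the right, `U b a U` collapses the sorted word to a
pure power, `b d a` keeps it sorted, and `E` adds only one letter where two are allowed. -/
theorem UbaU_add_bda_pow_le (h : AlternatingData U a b d E S C) (k : ℕ) :
    (U * (b * a) * U + b * d * a + E) ^ (k + 1) ≤ sorted U a b d (k + 1) + E ^ (2 * k + 1) := by
  have hE2 : E ≤ E ^ 2 := by simpa using h.pow_le_pow (show 1 ≤ 2 by omega)
  have hH : U * (b * a) * U + b * d * a + E ≤ E ^ 2 := add_le (add_le h.UbaU_le h.bda_le) hE2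
  induction k with
  | zero => simp [sorted]
  | succ k ih =>
    have hs := h.sorted_le (k + 1)
    have hm := h.sorted_mul_UbaU_le (k + 1)
    rw [pow_succ, sorted.eq_2 U a b d (k + 1)]
    set G := U * (b * a) * U
    set s := sorted U a b d (k + 1)
    have h1 : s * E ≤ E ^ (2 * k + 3) := by grw [hs, ← pow_succ]; rfl
    have h2 : E ^ (2 * k + 1) * (G + b * d * a + E) ≤ E ^ (2 * k + 3) := by
      grw [hH, ← pow_add]
    calc (G + b * d * a + E) ^ (k + 1) * (G + b * d * a + E)
        ≤ (s + E ^ (2 * k + 1)) * (G + b * d * a + E) := mul_le_mul_left ih _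
      _ = s * G + s * (b * d * a) + s * E + E ^ (2 * k + 1) * (G + b * d * a + E) := by
          rw [add_mul, mul_add, mul_add]
      _ ≤ (G ^ (k + 1 + 1) + E ^ (2 * k + 3)) + s * (b * d * a) + E ^ (2 * k + 3) +
          E ^ (2 * k + 3) := add_le_add (add_le_add (add_le_add hm le_rfl) h1) h2
      _ = _ := by
          rw [add_assoc _ (E ^ (2 * k + 3)), add_idem, add_right_comm (G ^ (k + 1 + 1)),
            add_assoc _ (E ^ (2 * k + 3)), add_idem]
          rfl

/-- Alternating words of even length, up to shorter words. -/
theorem UbUa_pow_le_sorted (h : AlternatingData U a b d E S C) (k : ℕ) :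
    ∃ x, (U * b * U * a) ^ (k + 1) ≤ U * x ∧ x * U ≤ sorted U a b d (k + 1) + E ^ (2 * k + 1) := by
  have hle := h.UbaU_add_bda_pow_le k
  have hU : U * b * U * a ≤ U * (U * (b * a) * U + b * d * a + E) := by
    calc U * b * U * a = U * (b * U * a) := by simp only [mul_assoc]
      _ ≤ U * (U * (b * a) * U + U * (b * d * a) * U) := by grw [h.bUa]
      _ = U * (U * (b * a) * U + b * d * a * U) := by
        rw [mul_add, mul_add]; simp only [← mul_assoc, h.U_mul_U]
      _ ≤ U * (U * (b * a) * U + (b * d * a + U * (b * a) * U + E)) := by grw [h.bdaU]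
      _ = _ := by
        rw [add_comm (b * d * a), add_assoc, ← add_assoc, add_idem]
  -- `H` absorbs `U` on its right, so in a power of `U H` only the leading `U` survives; cyclicity
  -- later carries it to the right end.
  have hHU : (U * (b * a) * U + b * d * a + E) * U ≤ U * (b * a) * U + b * d * a + E := by
    have h1 := h.bdaU
    have h2 : U * (b * a) * U * U = U * (b * a) * U := by rw [mul_assoc _ U U, h.U_mul_U]
    rw [add_mul, add_mul, h2, h.E_mul_U]
    refine add_le (add_le ?_ (h1.trans ?_)) le_add_self
    · rw [add_assoc]; exact le_self_add
    · rw [add_comm (b * d * a)]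
  set H := U * (b * a) * U + b * d * a + E
  refine ⟨H ^ (k + 1), ?_, ?_⟩
  swap
  · refine le_trans ?_ hle
    rw [pow_succ, mul_assoc]
    grw [hHU]
  grw [pow_le_pow_left' hU]
  clear hle
  induction k with
  | zero => simp
  | succ k ih =>
    calc (U * H) ^ (k + 1 + 1) ≤ U * H ^ (k + 1) * (U * H) := by rw [pow_succ]; grw [ih]
      _ = U * H ^ k * (H * U) * H := by rw [pow_succ]; simp only [mul_assoc]
      _ ≤ U * H ^ k * H * H := by grw [hHU]
      _ = _ := by simp only [pow_succ, mul_assoc]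

/-! ### Vanishing of traces by word length -/

/-- A mixed sorted word, once rotated, has its factors `b d a` in front of those in `U b a U` and
turns into a pure power. So only the two pure powers need the hypothesis on `b S`. -/
theorem null_sorted (h : AlternatingData U a b d E S C) {Z : A → Prop} (hZ : IsTraceNull Z)
    (hS : Z (b * S)) (K : ℕ)
    (hE : Z (E ^ (2 * K + 1))) : Z (sorted U a b d (K + 1)) := by
  have hG : Z ((U * (b * a) * U) ^ (K + 1)) := by
    have e (k : ℕ) : (U * (b * a) * U) ^ (k + 1) = U * (b * a * U) ^ (k + 1) := by
      induction k with
      | zero => simp [mul_assoc]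
      | succ k ih =>
        rw [pow_succ, ih, pow_succ _ (k + 1), pow_succ _ k]
        simp only [mul_assoc]
        simp only [← mul_assoc U U, h.U_mul_U]
    rw [e]
    refine hZ.comm (hZ.mono ?_ (hZ.add hS hE))
    rw [pow_succ, mul_assoc, mul_assoc _ U U, h.U_mul_U, ← pow_succ]
    exact h.baU_pow_le K
  have hD : Z ((b * d * a) ^ (K + 1)) := by
    -- Moving the first `b` to the end turns this into a power of `d a b`, where `Uab_pow_le`
    -- applies.
    have e : (b * d * a) ^ (K + 1) = b * ((d * a * b) ^ K * (d * a)) := by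
      rw [mul_assoc b, pow_succ, ← mul_assoc, mul_pow_mul, mul_assoc]
    rw [e]
    refine hZ.comm ?_
    rw [mul_assoc, ← pow_succ]
    refine hZ.mono ((pow_le_pow_left' ?_ _).trans (h.Uab_pow_le K)) (hZ.add (hZ.comm hS) hE)
    grw [h.d_le]
  have key : ∀ k j, k + j = K + 1 → Z (sorted U a b d k * (b * d * a) ^ j) := by
    intro k
    induction k with
    | zero =>
      intro j hj
      rw [zero_add] at hj
      simpa [sorted, hj] using hD
    | succ k ih =>
      intro j hj
      rw [sorted, add_mul]
      refine hZ.add (hZ.comm (hZ.mono (h.bda_pow_mul_UbaU_pow_le j k) ?_)) ?_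
      · rw [show k + 1 + j = K + 1 by omega, show k + j = K by omega]
        exact hZ.add hG hE
      · rw [mul_assoc, ← pow_succ']
        exact ih _ (by omega)
  simpa using key (K + 1) 0 rfl

/-- If the products with at most `2 K + 1` letters in `{a, b}` are null, so are those with
at most `2 K + 2`. -/
theorem null_even (h : AlternatingData U a b d E S C) {Z : A → Prop} (hZ : IsTraceNull Z)
    (hS : Z (b * S)) (K : ℕ)
    (hE : Z (E ^ (2 * K + 1))) : Z (E ^ (2 * K + 2)) := by
  have h1 : Z ((U * b * U * a) ^ (K + 1)) := by
    obtain ⟨x, hx, hxU⟩ := h.UbUa_pow_le_sorted K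
    exact hZ.mono hx (hZ.comm (hZ.mono hxU (hZ.add (h.null_sorted hZ hS K hE) hE)))
  refine hZ.mono (h.pow_le_alternating K).2 (hZ.add (hZ.add hE ?_) ?_)
  · refine hZ.comm ?_
    rw [pow_succ'] at h1 ⊢
    simpa only [mul_assoc, ← mul_assoc U U, h.U_mul_U] using h1
  · have e : (U * a * U * b) ^ (K + 1) * U =
        U * a * ((U * b * U * a) ^ K * (U * b * U)) := by
      rw [mul_assoc (U * a), mul_assoc (U * b), pow_succ, ← mul_assoc, mul_pow_mul]
      simp only [mul_assoc]
    rw [e]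
    refine hZ.comm ?_
    rw [pow_succ] at h1
    simpa only [mul_assoc, ← mul_assoc U U, h.U_mul_U] using h1

/-- If the products with at most `2 k + 2` letters in `{a, b}` are null, so are those with
at most `2 k + 3`. -/
theorem null_odd (h : AlternatingData U a b d E S C) {Z : A → Prop} (hZ : IsTraceNull Z) (k : ℕ)
    (hE : Z (E ^ (2 * k + 2))) : Z (E ^ (2 * k + 3)) := by
  refine hZ.mono (h.pow_le_alternating (k + 1)).1 (hZ.add (hZ.add ?_ ?_) ?_)
  · rwa [show 2 * (k + 1) = 2 * k + 1 + 1 by ring, h.pow_mul_U]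
  -- The first and last letters agree; after rotation they meet in `b U b`.
  · rw [mul_assoc, mul_assoc]
    refine hZ.comm (hZ.mono ?_ hE)
    calc U * (b * U) * (U * b * U * a) ^ (k + 1)
        = U * (b * U * b) * (U * a) * (U * b * U * a) ^ k := by
          rw [pow_succ']; simp only [mul_assoc, ← mul_assoc U U, h.U_mul_U]
      _ ≤ U * E * (U * E) * E ^ (2 * k) := by grw [h.UbUa_pow_le, h.bUb, h.a_le_E]
      _ = _ := by rw [h.U_mul_E, ← pow_two, ← pow_add, add_comm]
  · rw [mul_assoc, mul_assoc]
    refine hZ.comm (hZ.mono ?_ hE)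
    calc U * (a * U) * (U * a * U * b) ^ (k + 1)
        = U * (a * U * a) * (U * b) * (U * a * U * b) ^ k := by
          rw [pow_succ']; simp only [mul_assoc, ← mul_assoc U U, h.U_mul_U]
      _ ≤ U * E * (U * E) * E ^ (2 * k) := by grw [h.UaUb_pow_le, h.aUa, h.b_le_E]
      _ = _ := by rw [h.U_mul_E, ← pow_two, ← pow_add, add_comm]

/-- `U b U` rotates to `b U`, inside `b S`. For `U a U`, the relation for `c` trades `a` for terms
that lie in `S`, `b S` or `S b` after multiplication by `U`. -/
theorem null_one (h : AlternatingData U a b d E S C) {Z : A → Prop} (hZ : IsTraceNull Z)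
    (hS : Z S) (hbS : Z (b * S)) : Z E := by
  rw [h.hE]
  have hUS : b * U ≤ b * S := mul_le_mul_right h.U_le_S b
  refine hZ.add (hZ.add (hZ.mono h.U_le_S hS) ?_) ?_
  · rw [mul_assoc]
    refine hZ.comm (hZ.mono ?_ hbS)
    rwa [mul_assoc, h.U_mul_U]
  · rw [mul_assoc]
    refine hZ.comm ?_
    rw [mul_assoc, h.U_mul_U]
    refine hZ.mono (mul_le_mul_left h.a_le U) ?_
    rw [add_mul, add_mul, add_mul]
    refine hZ.add (hZ.add (hZ.add (hZ.mono ?_ hS) (hZ.mono hUS hbS)) (hZ.mono ?_ hbS)) ?_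
    · grw [h.C_le_S, h.U_le_S, h.S_mul_le]
    · calc b * a * U ≤ b * S * U := mul_le_mul_left h.ba_le_bS U
        _ ≤ b * (S * S) := by grw [h.U_le_S, mul_assoc]
        _ ≤ _ := by grw [h.S_mul_le]
    · refine hZ.mono (mul_le_mul_left h.ab_le_Sb U) ?_
      rw [mul_assoc]
      refine hZ.comm (hZ.mono ?_ hbS)
      grw [h.U_le_S, mul_assoc, h.S_mul_le]

/-- All words are null as soon as `S` and `b S` are. -/
theorem null_pow (h : AlternatingData U a b d E S C) {Z : A → Prop} (hZ : IsTraceNull Z)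
    (hS : Z S) (hbS : Z (b * S)) (p : ℕ) :
    Z (E ^ p) := by
  have odd : ∀ k, Z (E ^ (2 * k + 1)) := by
    intro k
    induction k with
    | zero => simpa using h.null_one hZ hS hbS
    | succ k ih => exact h.null_odd hZ k (h.null_even hZ hbS k ih)
  exact hZ.mono (h.pow_le_pow (by omega)) (odd p)

end AlternatingData
end CyclicReduction

/-! ### Normal forms in Temperley–Lieb chains -/

section TLChain

variable {K R : Type*} [CommRing K] [Ring R] [Algebra K R]

open Submodule

/-- The span of all products of the elements `x i` with `lo ≤ i < hi`. -/
def wordSpan (K : Type*) {R : Type*} [CommRing K] [Ring R] [Algebra K R] (x : ℕ → R)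
    (lo hi : ℕ) : Submodule K R :=
  Subalgebra.toSubmodule (Algebra.adjoin K {y | ∃ i, lo ≤ i ∧ i < hi ∧ y = x i})

theorem one_le_wordSpan (x : ℕ → R) (lo hi : ℕ) : 1 ≤ wordSpan K x lo hi :=
  Submodule.one_le.2 (one_mem (Algebra.adjoin K {y | ∃ i, lo ≤ i ∧ i < hi ∧ y = x i}))

theorem wordSpan_mul_self (x : ℕ → R) (lo hi : ℕ) :
    wordSpan K x lo hi * wordSpan K x lo hi = wordSpan K x lo hi :=
  (Algebra.adjoin K _).isIdempotentElem_toSubmodule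

theorem wordSpan_mono (x : ℕ → R) {lo hi lo' hi' : ℕ} (h₁ : lo' ≤ lo) (h₂ : hi ≤ hi') :
    wordSpan K x lo hi ≤ wordSpan K x lo' hi' := by
  refine Subalgebra.toSubmodule.monotone (Algebra.adjoin_mono ?_)
  rintro _ ⟨i, h, h', rfl⟩
  exact ⟨i, h₁.trans h, h'.trans_le h₂, rfl⟩

theorem span_le_wordSpan (x : ℕ → R) {lo hi i : ℕ} (h₁ : lo ≤ i) (h₂ : i < hi) :
    span K {x i} ≤ wordSpan K x lo hi :=
  (span_singleton_le_iff_mem _ _).2 (Algebra.subset_adjoin ⟨i, h₁, h₂, rfl⟩)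

theorem mul_wordSpan_le {x : ℕ → R} {lo hi : ℕ} {Y Z : Submodule K R} (h1 : Y ≤ Z)
    (hx : ∀ i, lo ≤ i → i < hi → Z * span K {x i} ≤ Z) : Y * wordSpan K x lo hi ≤ Z := by
  refine mul_le.2 fun y hy w hw ↦ ?_
  suffices wordSpan K x lo hi ≤ Z.comap (LinearMap.mulLeft K y) from this hw
  rw [wordSpan, Algebra.adjoin_eq_span, span_le]
  intro w hw
  induction hw using Submonoid.closure_induction_right with
  | one => simpa using h1 hy
  | mul_right w _ z hz ih =>
    obtain ⟨i, h, h', rfl⟩ := hz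
    simpa [mul_assoc] using hx i h h' (mul_mem_mul ih (mem_span_singleton_self _))

theorem wordSpan_le {x : ℕ → R} {lo hi : ℕ} {Z : Submodule K R} (h1 : 1 ≤ Z)
    (hx : ∀ i, lo ≤ i → i < hi → Z * span K {x i} ≤ Z) : wordSpan K x lo hi ≤ Z := by
  simpa using mul_wordSpan_le h1 hx

theorem wordSpan_eq_one (x : ℕ → R) {lo hi : ℕ} (h : hi ≤ lo) : wordSpan K x lo hi = 1 :=
  le_antisymm (wordSpan_le le_rfl fun i _ _ ↦ absurd h (by omega)) (one_le_wordSpan x lo hi)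

theorem wordSpan_comm {x : ℕ → R} {lo hi : ℕ} {y : R}
    (h : ∀ i, lo ≤ i → i < hi → x i * y = y * x i) :
    wordSpan K x lo hi * span K {y} = span K {y} * wordSpan K x lo hi := by
  have key : ∀ w ∈ wordSpan K x lo hi, w * y = y * w := by
    have : Algebra.adjoin K {z | ∃ i, lo ≤ i ∧ i < hi ∧ z = x i} ≤ Subalgebra.centralizer K {y} := by
      refine Algebra.adjoin_le ?_
      rintro _ ⟨i, h1, h2, rfl⟩
      simpa [Set.mem_centralizer_iff] using (h i h1 h2).symm
    intro w hw
    simpa [Subalgebra.mem_centralizer_iff] using (this hw y rfl).symm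
  refine le_antisymm (mul_le.2 fun w hw z hz ↦ ?_) (mul_le.2 fun z hz w hw ↦ ?_)
  all_goals obtain ⟨c, rfl⟩ := mem_span_singleton.1 hz
  · rw [mul_smul_comm, key w hw, ← smul_mul_assoc]
    exact mul_mem_mul hz hw
  · rw [smul_mul_assoc, ← key w hw, ← mul_smul_comm]
    exact mul_mem_mul hw hz

/-- Two occurrences of the top generator merge into one, so words with at most one occurrence
already span. -/
theorem wordSpan_succ_le_of {x : ℕ → R} {lo hi : ℕ}
    (hB : span K {x hi} * wordSpan K x lo hi * span K {x hi} ≤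
      wordSpan K x lo hi * span K {x hi} * wordSpan K x lo hi) :
    wordSpan K x lo (hi + 1) ≤
      wordSpan K x lo hi + wordSpan K x lo hi * span K {x hi} * wordSpan K x lo hi := by
  have hW := wordSpan_mul_self (K := K) x lo hi
  have h1 := one_le_wordSpan (K := K) x lo hi
  refine wordSpan_le (h1.trans le_self_add) fun i hi1 hi2 ↦ ?_
  rcases Nat.lt_succ_iff_lt_or_eq.1 hi2 with hlt | rfl
  · have hx := span_le_wordSpan (K := K) x hi1 hlt
    rw [add_mul, mul_assoc _ (wordSpan K x lo hi)]
    grw [hx, hW]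
  · set W := wordSpan K x lo i
    set b := span K {x i}
    rw [add_mul]
    refine add_le ((le_mul_of_one_le_right' h1).trans le_add_self) ?_
    calc W * b * W * b = W * (b * W * b) := by simp only [mul_assoc]
      _ ≤ W * (W * b * W) := by grw [hB]
      _ = W * b * W := by simp only [← mul_assoc, hW]
      _ ≤ _ := le_add_self

/-- Generators `x 1, …, x n` of Temperley–Lieb type, up to scalars. -/
structure IsTLChain (K : Type*) {R : Type*} [CommRing K] [Ring R] [Algebra K R] (x : ℕ → R)
    (n : ℕ) : Prop where
  sq : ∀ i, 1 ≤ i → i ≤ n → span K {x i} * span K {x i} ≤ span K {x i}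
  up : ∀ i, 1 ≤ i → i + 1 ≤ n →
    span K {x i} * span K {x (i + 1)} * span K {x i} ≤ span K {x i}
  down : ∀ i, 1 ≤ i → i + 1 ≤ n →
    span K {x (i + 1)} * span K {x i} * span K {x (i + 1)} ≤ span K {x (i + 1)}
  comm : ∀ i j, 1 ≤ i → i + 2 ≤ j → j ≤ n → x i * x j = x j * x i

/-- The line spanned by `x m ⋯ x 1`. -/
def descending (K : Type*) {R : Type*} [CommRing K] [Ring R] [Algebra K R] (x : ℕ → R) :
    ℕ → Submodule K R
  | 0 => 1
  | m + 1 => span K {x (m + 1)} * descending K x m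

theorem descending_le (x : ℕ → R) (m : ℕ) : descending K x m ≤ wordSpan K x 1 (m + 1) := by
  induction m with
  | zero => exact one_le_wordSpan x _ _
  | succ m ih =>
    rw [descending, ← wordSpan_mul_self]
    exact mul_le_mul' (span_le_wordSpan x (by omega) (by omega))
      (ih.trans (wordSpan_mono x le_rfl (by omega)))

namespace IsTLChain

variable {x : ℕ → R} {n : ℕ}

theorem wordSpan_comm_span (h : IsTLChain K x n) {lo hi j : ℕ} (hlo : 1 ≤ lo) (hj : hi < j)
    (hjn : j ≤ n) :
    wordSpan K x lo hi * span K {x j} = span K {x j} * wordSpan K x lo hi :=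
  wordSpan_comm fun i h1 h2 ↦ h.comm i j (by omega) (by omega) hjn

/-- By induction the word between the two top generators `b` contains the next generator `y` at most
once. Everything else commutes with `b`, so what remains is `b b` or `b y b`. -/
theorem span_mul_wordSpan_mul_span_le (h : IsTLChain K x n) {lo hi : ℕ} (hlo : 1 ≤ lo)
    (hlh : lo ≤ hi) (hn : hi ≤ n) :
    span K {x hi} * wordSpan K x lo hi * span K {x hi} ≤
      wordSpan K x lo hi * span K {x hi} * wordSpan K x lo hi := by
  induction hi, hlh using Nat.le_induction with
  | base =>
    rw [wordSpan_eq_one x le_rfl, mul_one, one_mul, mul_one]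
    exact h.sq lo hlo hn
  | succ k hk ih =>
    have hA := wordSpan_succ_le_of (ih (by omega))
    have hc := h.wordSpan_comm_span (lo := lo) (hi := k) hlo (Nat.lt_succ_self k) hn
    have hs := h.sq (k + 1) (by omega) hn
    have hd := h.down k (by omega) hn
    have hm : wordSpan K x lo k ≤ wordSpan K x lo (k + 1) := wordSpan_mono x le_rfl (by omega)
    have h1 := one_le_wordSpan (K := K) x lo (k + 1)
    have hW := wordSpan_mul_self (K := K) x lo (k + 1)
    grw [hA]
    set W := wordSpan K x lo k
    set W' := wordSpan K x lo (k + 1)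
    set b := span K {x (k + 1)}
    set y := span K {x k}
    rw [mul_add, add_mul]
    refine add_le ?_ ?_
    · calc b * W * b = W * (b * b) := by rw [← hc, mul_assoc]
        _ ≤ W' * b * 1 := by grw [hs, hm, mul_one]
        _ ≤ _ := by grw [h1]
    · calc b * (W * y * W) * b = b * W * y * (W * b) := by simp only [mul_assoc]
        _ = W * b * y * (b * W) := congrArg₂ (· * y * ·) hc.symm hc
        _ = W * (b * y * b) * W := by simp only [mul_assoc]
        _ ≤ _ := by grw [hd, hm]

theorem wordSpan_succ_le (h : IsTLChain K x n) {lo hi : ℕ} (hlo : 1 ≤ lo) (hlh : lo ≤ hi)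
    (hn : hi ≤ n) :
    wordSpan K x lo (hi + 1) ≤
      wordSpan K x lo hi + wordSpan K x lo hi * span K {x hi} * wordSpan K x lo hi :=
  wordSpan_succ_le_of (h.span_mul_wordSpan_mul_span_le hlo hlh hn)

/-- Prepares `b U a`: the generators with index below `m` commute with `b`, those with index above
`1` commute with `a`, and the descending word is the only one that cannot be split accordingly. -/
theorem wordSpan_le_descending (h : IsTLChain K x n) {m : ℕ} (hm : m ≤ n) :
    wordSpan K x 1 (m + 1) ≤ wordSpan K x 1 m * wordSpan K x 2 (m + 1) +
      wordSpan K x 1 m * descending K x m := by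
  induction m with
  | zero =>
    rw [wordSpan_eq_one x le_rfl, wordSpan_eq_one x (by omega), wordSpan_eq_one x (by omega),
      descending, mul_one]
    exact le_self_add
  | succ m ih =>
    have hA := h.wordSpan_succ_le (lo := 1) (hi := m + 1) le_rfl (by omega) hm
    have ih := ih (by omega)
    have hc := h.wordSpan_comm_span (lo := 1) (hi := m) le_rfl (Nat.lt_succ_self m) hm
    have hW := wordSpan_mul_self (K := K) x 1 (m + 1)
    have hV := wordSpan_mul_self (K := K) x 2 (m + 2)
    have h1 := one_le_wordSpan (K := K) x 2 (m + 2)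
    have hVV : wordSpan K x 2 (m + 1) ≤ wordSpan K x 2 (m + 2) := wordSpan_mono x le_rfl (by omega)
    have hm1 : wordSpan K x 1 m ≤ wordSpan K x 1 (m + 1) := wordSpan_mono x le_rfl (by omega)
    -- For `m = 0` the new generator is `x 1`, outside the second factor; it is then the descending
    -- word itself.
    have hb : m = 0 ∨ span K {x (m + 1)} ≤ wordSpan K x 2 (m + 2) := by
      rcases Nat.eq_zero_or_pos m with h0 | h0
      · exact Or.inl h0
      · exact Or.inr (span_le_wordSpan x (by omega) (by omega))
    rcases hb with rfl | hb
    · rw [descending, descending]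
      grw [hA, wordSpan_eq_one (K := K) x (lo := 1) (hi := 0 + 1) le_rfl]
      rw [one_mul, one_mul, one_mul, mul_one, wordSpan_eq_one x (by omega)]
    · refine hA.trans (add_le ((le_mul_of_one_le_right' h1).trans le_self_add) ?_)
      rw [descending]
      calc wordSpan K x 1 (m + 1) * span K {x (m + 1)} * wordSpan K x 1 (m + 1)
          ≤ wordSpan K x 1 (m + 1) * span K {x (m + 1)} *
            (wordSpan K x 1 m * wordSpan K x 2 (m + 1) + wordSpan K x 1 m * descending K x m) := by
            gcongr
        _ = wordSpan K x 1 (m + 1) * (span K {x (m + 1)} * wordSpan K x 1 m) * wordSpan K x 2 (m + 1) +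
            wordSpan K x 1 (m + 1) * (span K {x (m + 1)} * wordSpan K x 1 m) * descending K x m := by
            simp only [mul_add, mul_assoc]
        _ ≤ wordSpan K x 1 (m + 1) * wordSpan K x 1 (m + 1) *
              (wordSpan K x 2 (m + 2) * wordSpan K x 2 (m + 2)) +
            wordSpan K x 1 (m + 1) * wordSpan K x 1 (m + 1) *
              (span K {x (m + 1)} * descending K x m) := by
            rw [← hc, ← mul_assoc, mul_assoc _ _ (wordSpan K x 2 (m + 1)),
              mul_assoc _ _ (descending K x m)]
            refine add_le_add ?_ ?_
            · exact mul_le_mul' (mul_le_mul' le_rfl hm1) (mul_le_mul' hb hVV)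
            · exact mul_le_mul' (mul_le_mul' le_rfl hm1) le_rfl
        _ = _ := by rw [hW, hV]

/-- `x i` moves left until it meets `x i x (i - 1)` and cancels `x (i - 1)`. The word then breaks
into two commuting pieces, one in each factor. -/
theorem descending_mul_span_le (h : IsTLChain K x n) {m i : ℕ} (hm : m ≤ n) (hi : 2 ≤ i)
    (him : i ≤ m) :
    descending K x m * span K {x i} ≤ wordSpan K x 1 m * wordSpan K x 2 (m + 1) := by
  induction m with
  | zero => omega
  | succ m ih =>
    rcases Nat.lt_or_ge i (m + 1) with hlt | hge
    · have hc := h.wordSpan_comm_span (lo := 1) (hi := m) le_rfl (Nat.lt_succ_self m) hm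
      have hV := wordSpan_mul_self (K := K) x 2 (m + 2)
      rw [descending, mul_assoc]
      grw [ih (by omega) (by omega), ← mul_assoc, ← hc, mul_assoc]
      refine mul_le_mul' (wordSpan_mono x le_rfl (by omega)) ?_
      rw [← hV]
      exact mul_le_mul' (span_le_wordSpan x (by omega) (by omega))
        (wordSpan_mono x le_rfl (by omega))
    · obtain rfl : i = m + 1 := by omega
      obtain ⟨k, rfl⟩ : ∃ k, m = k + 1 := ⟨m - 1, by omega⟩
      have hc := h.wordSpan_comm_span (lo := 1) (hi := k + 1) le_rfl
        (show k + 1 < k + 1 + 1 by omega) hm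
      have hc' : descending K x k * span K {x (k + 1 + 1)} ≤
          span K {x (k + 1 + 1)} * wordSpan K x 1 (k + 1) := by
        rw [← hc]; grw [descending_le]
      calc descending K x (k + 1 + 1) * span K {x (k + 1 + 1)}
          = span K {x (k + 1 + 1)} * span K {x (k + 1)} *
            (descending K x k * span K {x (k + 1 + 1)}) := by
            simp only [descending, mul_assoc]
        _ ≤ span K {x (k + 1 + 1)} * span K {x (k + 1)} *
            (span K {x (k + 1 + 1)} * wordSpan K x 1 (k + 1)) := by grw [hc']
        _ ≤ span K {x (k + 1 + 1)} * wordSpan K x 1 (k + 1) := by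
            grw [← mul_assoc, h.down (k + 1) (by omega) hm]
        _ ≤ _ := by
            rw [← hc]
            exact mul_le_mul' (wordSpan_mono x le_rfl (by omega))
              (span_le_wordSpan x (by omega) (by omega))

theorem descending_mul_wordSpan_le (h : IsTLChain K x n) {m : ℕ} (hm : m ≤ n) :
    descending K x m * wordSpan K x 2 (m + 1) ≤
      descending K x m + wordSpan K x 1 m * wordSpan K x 2 (m + 1) := by
  refine mul_wordSpan_le le_self_add fun i h1 h2 ↦ ?_
  have hV := wordSpan_mul_self (K := K) x 2 (m + 1)
  rw [add_mul]
  refine add_le ((h.descending_mul_span_le hm h1 (by omega)).trans le_add_self) ?_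
  rw [mul_assoc]
  grw [span_le_wordSpan x h1 h2, hV]
  exact le_add_self

end IsTLChain
end TLChain

/-! ### The cycle of shifted generators -/

namespace AffineTL

open Submodule

variable {K : Type*} [CommRing K]

/-- The shifted generator `g + 1`, a scalar multiple of an idempotent. -/
def shifted (q : K) {n : ℕ} (s : AffGen n) : AffineTL K q n := gen q s + 1

theorem shifted_mul_self (q : K) {n : ℕ} (s : AffGen n) :
    shifted q s * shifted q s = (q + 1) • shifted q s := by
  have h := gen_mul_self q s
  rw [Algebra.algebraMap_eq_smul_one] at h
  simp only [shifted, mul_add, add_mul, h, mul_one, one_mul]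
  module

/-- The product is `V(x, y) + x² + x`, so after the shift `V = 0` becomes the Temperley–Lieb
relation. -/
theorem shifted_mul_shifted_mul_shifted {q : K} {R : Type*} [Ring R] [Algebra K R] {x y : R}
    (hx : x * x = (q - 1) • x + algebraMap K _ q) (hV : tlV x y = 0) :
    (x + 1) * (y + 1) * (x + 1) = q • (x + 1) := by
  have : (x + 1) * (y + 1) * (x + 1) = tlV x y + x * x + x := by
    simp only [tlV]; noncomm_ring
  rw [this, hV, hx, Algebra.algebraMap_eq_smul_one]
  module

theorem tlV_swap {R : Type*} [Ring R] {x y : R} (h : x * y * x = y * x * y) :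
    tlV y x = tlV x y := by
  simp only [tlV, h]; abel

/-- The shifted generators of the algebra of rank `n + 1`, with `g_{aₙ₊₁}` at index `0`. -/
def cyc (q : K) (n : ℕ) (hn : 2 ≤ n) (i : ℕ) : AffineTL K q (n + 1) :=
  if h : 1 ≤ i ∧ i ≤ n then shifted q (.sigma i h.1 (by omega)) else shifted q (.a (by omega))

theorem cyc_of_le (q : K) {n : ℕ} (hn : 2 ≤ n) {i : ℕ} (h₁ : 1 ≤ i) (h₂ : i ≤ n) :
    cyc q n hn i = gSigma q i h₁ (by omega) + 1 := by
  rw [cyc, dif_pos ⟨h₁, h₂⟩, shifted, gSigma]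

theorem cyc_zero (q : K) {n : ℕ} (hn : 2 ≤ n) :
    cyc q n hn 0 = gA q (n := n + 1) (by omega) + 1 := by
  rw [cyc, dif_neg (by omega), shifted, gA]

theorem cyc_mul_self (q : K) {n : ℕ} (hn : 2 ≤ n) (i : ℕ) :
    cyc q n hn i * cyc q n hn i = (q + 1) • cyc q n hn i := by
  unfold cyc; split_ifs <;> exact shifted_mul_self q _

theorem cyc_braid (q : K) {n : ℕ} (hn : 2 ≤ n) {i : ℕ} (h₁ : 1 ≤ i) (h₂ : i + 1 ≤ n) :
    cyc q n hn i * cyc q n hn (i + 1) * cyc q n hn i = q • cyc q n hn i ∧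
    cyc q n hn (i + 1) * cyc q n hn i * cyc q n hn (i + 1) = q • cyc q n hn (i + 1) := by
  rw [cyc_of_le q hn h₁ (by omega), cyc_of_le q hn (by omega) h₂]
  have hV := tlV_gSigma q (n := n + 1) i h₁ (by omega)
  refine ⟨shifted_mul_shifted_mul_shifted (gen_mul_self q _) hV,
    shifted_mul_shifted_mul_shifted (gen_mul_self q _) ?_⟩
  rw [tlV_swap (gSigma_braid q i h₁ (by omega)), hV]

theorem cyc_braid_zero (q : K) {n : ℕ} (hn : 2 ≤ n) {i : ℕ} (h : i = 1 ∨ i = n) :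
    cyc q n hn i * cyc q n hn 0 * cyc q n hn i = q • cyc q n hn i ∧
    cyc q n hn 0 * cyc q n hn i * cyc q n hn 0 = q • cyc q n hn 0 := by
  rw [cyc_of_le q hn (by omega) (by omega), cyc_zero]
  have hV := tlV_gSigma_gA q (n := n + 1) i (by omega) (by omega)
  refine ⟨shifted_mul_shifted_mul_shifted (gen_mul_self q _) hV,
    shifted_mul_shifted_mul_shifted (gen_mul_self q _) ?_⟩
  rw [tlV_swap (gSigma_gA_braid q i (by omega) (by omega)), hV]

theorem add_one_mul_add_one_comm {R : Type*} [Ring R] {x y : R} (h : x * y = y * x) :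
    (x + 1) * (y + 1) = (y + 1) * (x + 1) := by
  simp only [mul_add, add_mul, h, mul_one, one_mul]; abel

theorem cyc_comm (q : K) {n : ℕ} (hn : 2 ≤ n) {i j : ℕ} (h₁ : 1 ≤ i) (hij : i + 2 ≤ j)
    (h₂ : j ≤ n) : cyc q n hn i * cyc q n hn j = cyc q n hn j * cyc q n hn i := by
  rw [cyc_of_le q hn h₁ (by omega), cyc_of_le q hn (by omega) h₂]
  exact add_one_mul_add_one_comm (gSigma_comm q _ _ _ _ _ _ (Or.inl hij))

theorem cyc_comm_zero (q : K) {n : ℕ} (hn : 2 ≤ n) {i : ℕ} (h₁ : 2 ≤ i) (h₂ : i + 1 ≤ n) :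
    cyc q n hn i * cyc q n hn 0 = cyc q n hn 0 * cyc q n hn i := by
  rw [cyc_of_le q hn (by omega) (by omega), cyc_zero]
  exact add_one_mul_add_one_comm (gSigma_gA_comm q _ h₁ (by omega))

theorem span_mul_span_le {R : Type*} [Ring R] [Algebra K R] {x y z : R} {c : K}
    (h : x * y = c • z) : span K {x} * span K {y} ≤ span K {z} := by
  rw [span_mul_span, Set.singleton_mul_singleton, h, span_singleton_le_iff_mem]
  exact smul_mem _ _ (mem_span_singleton_self z)

theorem span_mul_span_mul_span_le {R : Type*} [Ring R] [Algebra K R] {x y z : R} {c : K}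
    (h : x * y * x = c • z) : span K {x} * span K {y} * span K {x} ≤ span K {z} := by
  rw [span_mul_span, Set.singleton_mul_singleton]
  exact span_mul_span_le h

theorem isTLChain_cyc (q : K) {n : ℕ} (hn : 2 ≤ n) : IsTLChain K (cyc q n hn) n where
  sq _ _ _ := span_mul_span_le (cyc_mul_self q hn _)
  up _ h₁ h₂ := span_mul_span_mul_span_le (cyc_braid q hn h₁ h₂).1
  down _ h₁ h₂ := span_mul_span_mul_span_le (cyc_braid q hn h₁ h₂).2
  comm _ _ h₁ h h₂ := cyc_comm q hn h₁ h h₂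

/-- Removing node `n` instead of node `0` from the cycle also leaves a chain, read from `n - 1` down
to `0`. It supplies the statements about `a` that mirror those about `b`. -/
theorem isTLChain_cyc_reverse (q : K) {n : ℕ} (hn : 2 ≤ n) :
    IsTLChain K (fun i ↦ cyc q n hn (n - i)) n where
  sq _ _ _ := span_mul_span_le (cyc_mul_self q hn _)
  up i h₁ h₂ := by
    refine span_mul_span_mul_span_le (c := q) ?_
    rcases Nat.lt_or_eq_of_le h₂ with h | h
    · have := (cyc_braid q hn (i := n - (i + 1)) (by omega) (by omega)).2
      rwa [show n - (i + 1) + 1 = n - i by omega] at this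
    · rw [show n - (i + 1) = 0 by omega]
      exact (cyc_braid_zero q hn (by omega)).1
  down i h₁ h₂ := by
    refine span_mul_span_mul_span_le (c := q) ?_
    rcases Nat.lt_or_eq_of_le h₂ with h | h
    · have := (cyc_braid q hn (i := n - (i + 1)) (by omega) (by omega)).1
      rwa [show n - (i + 1) + 1 = n - i by omega] at this
    · rw [show n - (i + 1) = 0 by omega]
      exact (cyc_braid_zero q hn (by omega)).2
  comm i j h₁ h h₂ := by
    rcases Nat.lt_or_eq_of_le h₂ with h' | h'
    · exact (cyc_comm q hn (by omega) (by omega) (by omega)).symm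
    · rw [show n - j = 0 by omega]
      exact cyc_comm_zero q hn (by omega) (by omega)

theorem wordSpan_reverse {R : Type*} [Ring R] [Algebra K R] (x : ℕ → R) {n m : ℕ} (hm : m ≤ n) :
    wordSpan K (fun i ↦ x (n - i)) 1 m = wordSpan K x (n - m + 1) n := by
  unfold wordSpan
  congr 2
  ext y
  constructor
  · rintro ⟨i, h1, h2, rfl⟩
    exact ⟨n - i, by omega, by omega, rfl⟩
  · rintro ⟨i, h1, h2, rfl⟩
    exact ⟨n - i, by omega, by omega, by simp only [show n - (n - i) = i by omega]⟩

/-! ### The additional generator of the image of the tower morphism -/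

/-- The image under the tower morphism of the shifted generator `g_{aₙ} + 1`. -/
theorem F_shifted_a (q : Kˣ) {n : ℕ} (hn : 2 ≤ n) :
    F q n (shifted (q : K) (.a hn)) =
      cyc (q : K) n hn n + cyc (q : K) n hn 0 - cyc (q : K) n hn n * cyc (q : K) n hn 0 -
        ((q⁻¹ : Kˣ) : K) • (cyc (q : K) n hn 0 * cyc (q : K) n hn n) := by
  have hinv : (((uSigma q n (by omega) le_rfl)⁻¹ : (AffineTL K (q : K) (n + 1))ˣ) :
      AffineTL K (q : K) (n + 1)) =
      ((q⁻¹ : Kˣ) : K) • (cyc (q : K) n hn n - (q : K) • 1) := by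
    rw [cyc_of_le _ hn (by omega) le_rfl]
    change ((q⁻¹ : Kˣ) : K) • (gSigma (q : K) n (by omega) le_rfl - algebraMap K _ ((q : K) - 1)) = _
    rw [Algebra.algebraMap_eq_smul_one]
    congr 1
    module
  have hu := (uSigma q n (by omega) le_rfl : (AffineTL K (q : K) (n + 1))ˣ).mul_inv
  have hσ : gSigma (q : K) (n := n + 1) n (by omega) le_rfl = cyc (q : K) n hn n - 1 := by
    rw [cyc_of_le _ hn (by omega) le_rfl, add_sub_cancel_right]
  have ha : gA (q : K) (n := n + 1) (by omega) = cyc (q : K) n hn 0 - 1 := by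
    rw [cyc_zero, add_sub_cancel_right]
  -- The `-1` in `g_{aₙ₊₁} = e_0 - 1`, once conjugated, cancels the shift by `1`.
  have h1 : F q n (shifted (q : K) (.a hn)) = (cyc (q : K) n hn n - 1) * cyc (q : K) n hn 0 *
      (((q⁻¹ : Kˣ) : K) • (cyc (q : K) n hn n - (q : K) • 1)) := by
    rw [shifted, map_add, map_one, F_gen, towerGen_a, ← hinv]
    rw [val_uSigma] at hu ⊢
    rw [ha, ← hσ, mul_sub, mul_one, sub_mul, hu, sub_add_cancel]
  have h2 := (cyc_braid_zero (q : K) hn (Or.inr rfl)).1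
  rw [h1]
  simp only [sub_mul, mul_sub, mul_smul_comm, mul_one, one_mul, h2, smul_sub, smul_smul,
    Units.inv_mul, one_smul]
  abel

theorem descending_le_mul_span_one {R : Type*} [Ring R] [Algebra K R] (x : ℕ → R) (m : ℕ) :
    descending K x (m + 1) ≤ wordSpan K x 2 (m + 2) * span K {x 1} := by
  induction m with
  | zero =>
    rw [wordSpan_eq_one x (by omega), descending, descending, mul_one, one_mul]
  | succ m ih =>
    rw [descending, ← wordSpan_mul_self, mul_assoc]
    exact mul_le_mul' (span_le_wordSpan x (by omega) (by omega))
      (ih.trans (mul_le_mul' (wordSpan_mono x le_rfl (by omega)) le_rfl))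

/-- The span of the words in the shifted generators with at most one letter among
`g_{σₙ} + 1` and `g_{aₙ₊₁} + 1`. -/
def shortSpan (q : K) (n : ℕ) (hn : 2 ≤ n) : Submodule K (AffineTL K q (n + 1)) :=
  wordSpan K (cyc q n hn) 1 n +
    wordSpan K (cyc q n hn) 1 n * span K {cyc q n hn n} * wordSpan K (cyc q n hn) 1 n +
    wordSpan K (cyc q n hn) 1 n * span K {cyc q n hn 0} * wordSpan K (cyc q n hn) 1 n

/-- Multiplying the formula for `c` by `b` on the left gives `b c = q (b - b a)`, because `b a b = q
b`. -/
theorem cyc_mul_F_shifted_a (q : Kˣ) {n : ℕ} (hn : 2 ≤ n) :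
    cyc (q : K) n hn n * cyc (q : K) n hn 0 =
      cyc (q : K) n hn n * (1 - ((q⁻¹ : Kˣ) : K) • F q n (shifted (q : K) (.a hn))) := by
  have h1 := cyc_mul_self (q : K) hn n
  have h2 := (cyc_braid_zero (q : K) hn (Or.inr rfl)).1
  have h3 : ((q⁻¹ : Kˣ) : K) * ((q : K) + 1) = 1 + ((q⁻¹ : Kˣ) : K) := by
    rw [mul_add, Units.inv_mul, mul_one]
  have h4 : ((q⁻¹ : Kˣ) : K) * ((q⁻¹ : Kˣ) : K) * (q : K) = ((q⁻¹ : Kˣ) : K) := by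
    rw [mul_assoc, Units.inv_mul, mul_one]
  rw [F_shifted_a]
  simp only [mul_sub, mul_add, mul_one, mul_smul_comm, ← mul_assoc, h1, h2, smul_sub, smul_add,
    smul_smul, smul_mul_assoc, h3, h4]
  simp only [add_smul, one_smul]
  abel

theorem F_shifted_a_mul_cyc (q : Kˣ) {n : ℕ} (hn : 2 ≤ n) :
    cyc (q : K) n hn 0 * cyc (q : K) n hn n =
      ((q : K) • 1 - (q : K) • F q n (shifted (q : K) (.a hn))) * cyc (q : K) n hn n := by
  have h1 := cyc_mul_self (q : K) hn n
  have h2 := (cyc_braid_zero (q : K) hn (Or.inr rfl)).1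
  rw [F_shifted_a]
  simp only [sub_mul, add_mul, one_mul, smul_mul_assoc, mul_assoc, h1, smul_sub, smul_add,
    smul_smul, mul_smul_comm, Units.mul_inv]
  rw [← mul_assoc, h2]
  simp only [add_smul, one_smul, mul_add, smul_smul, mul_one]
  abel

theorem wordSpan_cyc_le_range (q : Kˣ) {n : ℕ} (hn : 2 ≤ n) :
    wordSpan K (cyc (q : K) n hn) 1 n ≤ Subalgebra.toSubmodule (F q n).range := by
  refine Subalgebra.toSubmodule.monotone (Algebra.adjoin_le ?_)
  rintro _ ⟨i, h1, h2, rfl⟩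
  refine ⟨gSigma (q : K) i h1 (by omega) + 1, ?_⟩
  change F q n _ = _
  rw [cyc_of_le _ hn h1 (by omega), map_add, map_one, gSigma, F_gen]
  rfl

/-! ### Verification of the axioms -/

/-- Generators of index at least `2` pass through `a` and are absorbed by `d` or split it. A
generator `x 1` meets the final `x 1` of `d` across `a`, and `x 1 · a · x 1` removes `a`. -/
theorem bdaU_le (q : K) {m : ℕ} (hm : 2 ≤ m + 1) :
    span K {cyc q (m + 1) hm (m + 1)} * descending K (cyc q (m + 1) hm) m *
        span K {cyc q (m + 1) hm 0} * wordSpan K (cyc q (m + 1) hm) 1 (m + 1) ≤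
      span K {cyc q (m + 1) hm (m + 1)} * descending K (cyc q (m + 1) hm) m *
        span K {cyc q (m + 1) hm 0} +
      wordSpan K (cyc q (m + 1) hm) 1 (m + 1) *
        (span K {cyc q (m + 1) hm (m + 1)} * span K {cyc q (m + 1) hm 0}) *
        wordSpan K (cyc q (m + 1) hm) 1 (m + 1) + shortSpan q (m + 1) hm := by
  have hx := isTLChain_cyc q hm
  have hy := isTLChain_cyc_reverse q hm
  -- In the reversed chain `x 1` is the top generator of `U`, so it occurs at most once in a word.
  have hA := hy.wordSpan_succ_le (lo := 1) (hi := m) le_rfl (by omega) (by omega)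
  rw [wordSpan_reverse (cyc q (m + 1) hm) le_rfl,
    wordSpan_reverse (cyc q (m + 1) hm) (Nat.le_succ m), Nat.sub_self,
    show m + 1 - m = 1 by omega] at hA
  have hb := hx.wordSpan_comm_span (lo := 1) (hi := m) le_rfl (Nat.lt_succ_self m) le_rfl
  have ha : wordSpan K (cyc q (m + 1) hm) 2 (m + 1) * span K {cyc q (m + 1) hm 0} =
      span K {cyc q (m + 1) hm 0} * wordSpan K (cyc q (m + 1) hm) 2 (m + 1) :=
    wordSpan_comm fun i h1 h2 ↦ cyc_comm_zero q hm h1 (by omega)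
  have hd := hx.descending_mul_wordSpan_le (Nat.le_succ m)
  have hd1 : descending K (cyc q (m + 1) hm) m ≤
      wordSpan K (cyc q (m + 1) hm) 2 (m + 1) * span K {cyc q (m + 1) hm 1} := by
    obtain ⟨k, rfl⟩ : ∃ k, m = k + 1 := ⟨m - 1, by omega⟩
    exact descending_le_mul_span_one _ k
  have h1a := span_mul_span_mul_span_le (cyc_braid_zero q hm (Or.inl rfl)).1
  have hx1 : span K {cyc q (m + 1) hm 1} ≤ wordSpan K (cyc q (m + 1) hm) 1 (m + 1) :=
    span_le_wordSpan _ le_rfl (by omega)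
  have hU1 : wordSpan K (cyc q (m + 1) hm) 1 m ≤ wordSpan K (cyc q (m + 1) hm) 1 (m + 1) :=
    wordSpan_mono _ le_rfl (by omega)
  have hU2 : wordSpan K (cyc q (m + 1) hm) 2 (m + 1) ≤ wordSpan K (cyc q (m + 1) hm) 1 (m + 1) :=
    wordSpan_mono _ (by omega) le_rfl
  have hUU := wordSpan_mul_self (K := K) (cyc q (m + 1) hm) 1 (m + 1)
  have hE : wordSpan K (cyc q (m + 1) hm) 1 (m + 1) * span K {cyc q (m + 1) hm (m + 1)} *
      wordSpan K (cyc q (m + 1) hm) 1 (m + 1) ≤ shortSpan q (m + 1) hm := by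
    rw [shortSpan]; exact le_self_add.trans' le_add_self
  have h1U := one_le_wordSpan (K := K) (cyc q (m + 1) hm) 1 (m + 1)
  set x := cyc q (m + 1) hm
  set U := wordSpan K x 1 (m + 1)
  set U₁ := wordSpan K x 1 m
  set U₂ := wordSpan K x 2 (m + 1)
  set b := span K {x (m + 1)}
  set a := span K {x 0}
  set d := descending K x m
  set c := span K {x 1}
  have h2 : b * d * a * U₂ ≤ b * d * a + U * (b * a) * U := by
    calc b * d * a * U₂ = b * (d * U₂) * a := by simp only [mul_assoc, ha]
      _ ≤ b * (d + U₁ * U₂) * a := by grw [hd]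
      _ = b * d * a + (b * U₁) * (U₂ * a) := by simp only [mul_add, add_mul, mul_assoc]
      _ = b * d * a + U₁ * (b * a) * U₂ := by rw [← hb, ha]; simp only [mul_assoc]
      _ ≤ _ := by grw [hU1, hU2]
  have h3 : b * d * a * c * U₂ ≤ shortSpan q (m + 1) hm := by
    calc b * d * a * c * U₂ ≤ b * (U₂ * c) * a * c * U₂ := by grw [hd1]
      _ = b * U₂ * (c * a * c) * U₂ := by simp only [mul_assoc]
      _ ≤ 1 * b * (U * (U * U)) := by
        rw [one_mul]; grw [h1a, hx1, hU2, mul_assoc, mul_assoc]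
      _ ≤ _ := by rw [hUU, hUU]; grw [h1U, hE]
  calc b * d * a * U ≤ b * d * a * (U₂ + U₂ * c * U₂) := by grw [hA]
    _ = b * d * a * U₂ + b * d * a * U₂ * (c * U₂) := by simp only [mul_add, mul_assoc]
    _ ≤ (b * d * a + U * (b * a) * U) + (b * d * a + U * (b * a) * U) * (c * U₂) := by grw [h2]
    _ = (b * d * a + U * (b * a) * U) + (b * d * a * c * U₂ + U * (b * a) * (U * (c * U₂))) := by
      simp only [add_mul, mul_assoc]
    _ ≤ (b * d * a + U * (b * a) * U) +
        (shortSpan q (m + 1) hm + U * (b * a) * (U * (U * U))) := by grw [h3, hx1, hU2]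
    _ = _ := by
      rw [hUU, hUU, add_comm (shortSpan q (m + 1) hm), add_assoc (b * d * a),
        ← add_assoc (U * (b * a) * U), add_idem, ← add_assoc (b * d * a)]

theorem alternatingData (q : Kˣ) {m : ℕ} (hm : 2 ≤ m + 1) :
    AlternatingData (wordSpan K (cyc (q : K) (m + 1) hm) 1 (m + 1))
      (span K {cyc (q : K) (m + 1) hm 0}) (span K {cyc (q : K) (m + 1) hm (m + 1)})
      (descending K (cyc (q : K) (m + 1) hm) m) (shortSpan (q : K) (m + 1) hm)
      (Subalgebra.toSubmodule (F q (m + 1)).range)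
      (span K {F q (m + 1) (shifted (q : K) (.a hm))}) := by
  have hx := isTLChain_cyc (q : K) hm
  have hc := F_shifted_a q hm
  have hba := cyc_mul_F_shifted_a q hm
  have hab := F_shifted_a_mul_cyc q hm
  have h1 := one_le_wordSpan (K := K) (cyc (q : K) (m + 1) hm) 1 (m + 1)
  have hF : F q (m + 1) (shifted (q : K) (.a hm)) ∈
      Subalgebra.toSubmodule (F q (m + 1)).range := ⟨_, rfl⟩
  have hSone : (1 : AffineTL K (q : K) (m + 1 + 1)) ∈
      Subalgebra.toSubmodule (F q (m + 1)).range := one_mem (F q (m + 1)).range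
  have hEU : wordSpan K (cyc (q : K) (m + 1) hm) 1 (m + 1) ≤ shortSpan (q : K) (m + 1) hm := by
    rw [shortSpan]; exact le_self_add.trans le_self_add
  have hEb : cyc (q : K) (m + 1) hm (m + 1) ∈ shortSpan (q : K) (m + 1) hm := by
    rw [← span_singleton_le_iff_mem, shortSpan]
    exact ((le_mul_of_one_le_left' h1).trans (le_mul_of_one_le_right' h1)).trans
      (le_self_add.trans' le_add_self)
  have hEa : cyc (q : K) (m + 1) hm 0 ∈ shortSpan (q : K) (m + 1) hm := by
    rw [← span_singleton_le_iff_mem, shortSpan]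
    exact ((le_mul_of_one_le_left' h1).trans (le_mul_of_one_le_right' h1)).trans le_add_self
  have hE1 := h1.trans hEU
  generalize F q (m + 1) (shifted (q : K) (.a hm)) = c at *
  have mem_add_left {M N : Submodule K (AffineTL K (q : K) (m + 1 + 1))} {y} (h : y ∈ M) :
      y ∈ M + N := (le_self_add : M ≤ M + N) h
  have mem_add_right {M N : Submodule K (AffineTL K (q : K) (m + 1 + 1))} {y} (h : y ∈ N) :
      y ∈ M + N := (le_add_self : N ≤ M + N) h
  have self (y : AffineTL K (q : K) (m + 1 + 1)) : y ∈ span K {y} := mem_span_singleton_self y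
  refine
    { one_le := h1
      U_mul_le := (wordSpan_mul_self _ _ _).le
      hE := rfl
      d_le := descending_le _ _
      bUb := ?_
      aUa := ?_
      bUa := ?_
      bdaU := bdaU_le (q : K) hm
      aba := span_mul_span_mul_span_le (cyc_braid_zero (q : K) hm (Or.inr rfl)).2
      U_le_S := wordSpan_cyc_le_range q hm
      C_le_S := (span_singleton_le_iff_mem _ _).2 hF
      S_mul_le := (F q (m + 1)).range.isIdempotentElem_toSubmodule.le
      C_le := ?_
      a_le := ?_
      ba_le := ?_
      ab_le := ?_
      ba_le_bS := ?_
      ab_le_Sb := ?_ }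
  · refine (hx.span_mul_wordSpan_mul_span_le le_rfl (by omega) le_rfl).trans ?_
    rw [shortSpan]
    exact le_self_add.trans' le_add_self
  · have := (isTLChain_cyc_reverse (q : K) hm).span_mul_wordSpan_mul_span_le (lo := 1)
      (hi := m + 1) le_rfl (by omega) le_rfl
    rw [wordSpan_reverse (cyc (q : K) (m + 1) hm) le_rfl, Nat.sub_self] at this
    exact this.trans le_add_self
  -- The words in `x 1, …, x (m - 1)` leave to the left past `b`, those in `x 2, …, x m` to the
  -- right past `a`.
  · have hU1 : wordSpan K (cyc (q : K) (m + 1) hm) 1 m ≤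
        wordSpan K (cyc (q : K) (m + 1) hm) 1 (m + 1) := wordSpan_mono _ le_rfl (by omega)
    have hU2 : wordSpan K (cyc (q : K) (m + 1) hm) 2 (m + 1) ≤
        wordSpan K (cyc (q : K) (m + 1) hm) 1 (m + 1) := wordSpan_mono _ (by omega) le_rfl
    have hb := hx.wordSpan_comm_span (lo := 1) (hi := m) le_rfl (Nat.lt_succ_self m) le_rfl
    have ha : wordSpan K (cyc (q : K) (m + 1) hm) 2 (m + 1) * span K {cyc (q : K) (m + 1) hm 0} =
        span K {cyc (q : K) (m + 1) hm 0} * wordSpan K (cyc (q : K) (m + 1) hm) 2 (m + 1) :=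
      wordSpan_comm fun i h1 h2 ↦ cyc_comm_zero (q : K) hm h1 (by omega)
    have hd := hx.wordSpan_le_descending (Nat.le_succ m)
    refine (mul_le_mul_left (mul_le_mul_right hd _) _).trans ?_
    rw [mul_add, add_mul]
    refine add_le_add ?_ ?_
    · rw [← mul_assoc, ← hb, mul_assoc _ _ (span K {cyc (q : K) (m + 1) hm 0}), ha,
        mul_assoc _ _ (_ * _), ← mul_assoc (span K {cyc (q : K) (m + 1) hm (m + 1)}), ← mul_assoc]
      exact mul_le_mul' (mul_le_mul' hU1 le_rfl) hU2
    · rw [← mul_assoc, ← hb, mul_assoc, mul_assoc, ← mul_assoc (span K _)]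
      exact (mul_le_mul' hU1 le_rfl).trans (le_mul_of_one_le_right' h1)
  · rw [span_singleton_le_iff_mem, hc]
    have h2 {y} (hy : y ∈ shortSpan (q : K) (m + 1) hm) :
        y ∈ shortSpan (q : K) (m + 1) hm * shortSpan (q : K) (m + 1) hm :=
      (le_mul_of_one_le_left' hE1 : _ ≤ _) hy
    exact sub_mem (sub_mem (add_mem (h2 hEb) (h2 hEa)) (mul_mem_mul hEb hEa))
      (smul_mem _ _ (mul_mem_mul hEa hEb))
  · rw [span_singleton_le_iff_mem]
    have e : cyc (q : K) (m + 1) hm 0 = c - cyc (q : K) (m + 1) hm (m + 1) +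
        cyc (q : K) (m + 1) hm (m + 1) * cyc (q : K) (m + 1) hm 0 + ((q⁻¹ : Kˣ) : K) •
          (cyc (q : K) (m + 1) hm 0 * cyc (q : K) (m + 1) hm (m + 1)) := by rw [hc]; abel
    refine Eq.mpr (congrArg (Membership.mem _) e) ?_
    exact add_mem (add_mem (sub_mem
      (mem_add_left (mem_add_left (mem_add_left (self _))))
      (mem_add_left (mem_add_left (mem_add_right (self _)))))
      (mem_add_left (mem_add_right (mul_mem_mul (self _) (self _)))))
      (smul_mem _ _ (mem_add_right (mul_mem_mul (self _) (self _))))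
  · rw [span_mul_span, Set.singleton_mul_singleton, span_singleton_le_iff_mem]
    have e : cyc (q : K) (m + 1) hm (m + 1) * cyc (q : K) (m + 1) hm 0 =
        cyc (q : K) (m + 1) hm (m + 1) + cyc (q : K) (m + 1) hm 0 - c - ((q⁻¹ : Kˣ) : K) •
          (cyc (q : K) (m + 1) hm 0 * cyc (q : K) (m + 1) hm (m + 1)) := by rw [hc]; abel
    rw [e]
    exact sub_mem (sub_mem (mem_add_right (add_mem hEb hEa))
      (mem_add_left (mem_add_left (self _))))
      (smul_mem _ _ (mem_add_left (mem_add_right (mul_mem_mul (self _) (self _)))))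
  · rw [span_mul_span, Set.singleton_mul_singleton, span_singleton_le_iff_mem]
    have e : cyc (q : K) (m + 1) hm 0 * cyc (q : K) (m + 1) hm (m + 1) =
        (q : K) • (cyc (q : K) (m + 1) hm (m + 1) + cyc (q : K) (m + 1) hm 0 - c -
          cyc (q : K) (m + 1) hm (m + 1) * cyc (q : K) (m + 1) hm 0) := by
      rw [hc]
      simp only [smul_sub, smul_add, smul_smul, Units.mul_inv, one_smul]
      abel
    rw [e]
    exact smul_mem _ _ (sub_mem (sub_mem (mem_add_right (add_mem hEb hEa))
      (mem_add_left (mem_add_left (self _))))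
      (mem_add_left (mem_add_right (mul_mem_mul (self _) (self _)))))
  · rw [span_mul_span, Set.singleton_mul_singleton, span_singleton_le_iff_mem, hba]
    exact mul_mem_mul (self _) (sub_mem hSone (smul_mem _ _ hF))
  · rw [span_mul_span, Set.singleton_mul_singleton, span_singleton_le_iff_mem, hab]
    exact mul_mem_mul (sub_mem (smul_mem _ _ hSone) (smul_mem _ _ hF)) (self _)

theorem exists_mem_shortSpan_pow (q : Kˣ) {m : ℕ} (hm : 2 ≤ m + 1)
    (z : AffineTL K (q : K) (m + 1 + 1)) : ∃ p, z ∈ shortSpan (q : K) (m + 1) hm ^ p := by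
  have D := alternatingData q hm
  have hcyc (i : ℕ) (hi : i ≤ m + 1) :
      cyc (q : K) (m + 1) hm i ∈ shortSpan (q : K) (m + 1) hm := by
    rw [← span_singleton_le_iff_mem]
    rcases Nat.eq_zero_or_pos i with rfl | h0
    · exact D.a_le_E
    rcases Nat.lt_or_eq_of_le hi with h1 | rfl
    · exact (span_le_wordSpan _ h0 h1).trans D.U_le_E
    · exact D.b_le_E
  have hone : (1 : AffineTL K (q : K) (m + 1 + 1)) ∈ shortSpan (q : K) (m + 1) hm :=
    Submodule.one_le.1 D.one_le_E
  obtain ⟨w, rfl⟩ := RingQuot.mkAlgHom_surjective K (AffRel K (q : K) (m + 1 + 1)) z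
  induction w using FreeAlgebra.induction with
  | grade0 r =>
    refine ⟨1, ?_⟩
    rw [pow_one, AlgHom.commutes, Algebra.algebraMap_eq_smul_one]
    exact smul_mem _ _ hone
  | grade1 s =>
    refine ⟨1, ?_⟩
    rw [pow_one]
    change gen (q : K) s ∈ _
    cases s with
    | sigma i h₁ h₂ =>
      have := sub_mem (hcyc i (by omega)) hone
      rwa [cyc_of_le _ hm h₁ (by omega), add_sub_cancel_right] at this
    | a h =>
      have := sub_mem (hcyc 0 (by omega)) hone
      rwa [cyc_zero, add_sub_cancel_right] at this
  | mul u v hu hv =>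
    obtain ⟨r, hr⟩ := hu
    obtain ⟨s, hs⟩ := hv
    refine ⟨r + s, ?_⟩
    rw [map_mul, pow_add]
    exact mul_mem_mul hr hs
  | add u v hu hv =>
    obtain ⟨r, hr⟩ := hu
    obtain ⟨s, hs⟩ := hv
    refine ⟨max r s, ?_⟩
    rw [map_add]
    exact add_mem (D.pow_le_pow (le_max_left r s) hr) (D.pow_le_pow (le_max_right r s) hs)

/-- Being annihilated by a trace is invariant under cyclic permutation. -/
theorem isTraceNull_le_ker {R : Type*} [Ring R] [Algebra K R] {T : R →ₗ[K] K}
    (hT : IsTraceForm T) : IsTraceNull fun M : Submodule K R ↦ M ≤ LinearMap.ker T where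
  mono h h' := h.trans h'
  add := add_le
  comm h := mul_le.2 fun x hx y hy ↦ by
    rw [LinearMap.mem_ker, hT]
    exact h (mul_mem_mul hy hx)

end AffineTL

/-! ### The theorem -/

theorem mainTheorem2 {K : Type*} [CommRing K] [IsDomain K] [CharZero K]
    (q : Kˣ) (hsq : IsSquare (q : K)) (hq : IsUnit ((q : K) + 1))
    (n : ℕ) (hn : 2 ≤ n)
    (τ τ' : AffineTL K (q : K) (n + 1) →ₗ[K] K)
    (hτ : IsTraceForm τ) (hτ' : IsTraceForm τ')
    (h : ∀ x : AffineTL K (q : K) (n + 1), AffineTL.IsMarkov q hn x → τ x = τ' x) :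
    τ = τ' := by
  obtain ⟨m, rfl⟩ : ∃ m, n = m + 1 := ⟨n - 1, by omega⟩
  have hT : IsTraceForm (τ - τ') := fun x y ↦ by
    rw [LinearMap.sub_apply, LinearMap.sub_apply, hτ x y, hτ' x y]
  have hS : ∀ s ∈ (AffineTL.F q (m + 1)).range, (τ - τ') s = 0 := fun s hs ↦
    sub_eq_zero.2 (h s ⟨s, hs, 1, one_mem _, 0, Or.inl rfl, by rw [pow_zero, mul_one, mul_one]⟩)
  have hbS : ∀ s ∈ (AffineTL.F q (m + 1)).range,
      (τ - τ') (AffineTL.cyc (q : K) (m + 1) hn (m + 1) * s) = 0 := fun s hs ↦ by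
    -- `(g_{σₙ} + 1) s` is a Markov element with exponent `1` plus an element of the image.
    rw [AffineTL.cyc_of_le (q : K) hn (by omega) le_rfl, add_mul, one_mul, map_add, hS s hs,
      add_zero]
    exact sub_eq_zero.2 (h _ ⟨1, one_mem _, s, hs, 1, Or.inr rfl, by rw [pow_one, one_mul]⟩)
  refine sub_eq_zero.1 (LinearMap.ext fun z ↦ ?_)
  obtain ⟨p, hp⟩ := AffineTL.exists_mem_shortSpan_pow q hn z
  refine (AffineTL.alternatingData q hn).null_pow (AffineTL.isTraceNull_le_ker hT) hS ?_ p hp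
  refine Submodule.mul_le.2 fun y hy s hs ↦ ?_
  obtain ⟨c, rfl⟩ := Submodule.mem_span_singleton.1 hy
  rw [LinearMap.mem_ker, smul_mul_assoc, map_smul, hbS s hs, smul_zero]
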